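/- **Theorem 4.4.** All spaces are Banach spaces over $\mathbb K\in\{\mathbb R,\mathbb C\}$; $\mathcal F(E,F)$ denotes the finite rank ("finite") operators, $\overline{\mathcal F}$ the approximable operators (operator-norm limits of finite operators) with the operator norm, and $j_F:F\to F''$ and $J_F:F\to \ell^\infty(B_{F'})$ the canonical isometric embeddings. For an operator ideal $(\mathcal B,\mathbf B)$: - the product $\mathcal B\circ\mathcal C$ consists of the operators $T=SR$ with $R\in\mathcal C(E,G)$, $S\in\mathcal B(G,F)$, $G$ a Banach space, with norm $\inf \mathbf B(S)\,\mathbf C(R)$ over all such factorizations; $\mathcal B^{min}:=\overline{\mathcal F}\circ\mathcal B\circ\overline{\mathcal F}$; - $\mathcal B^{inj}$ consists of the $T:E\to F$ with $J_FT\in\mathcal B$, with norm $\mathbf B^{inj}(T):=\mathbf B(J_FT)$; - $\mathbf B^{*}(T)$, for $T:E\to F$, is the infimum of all $c\ge 0$ with $|\mathrm{tr}(TUSR)|\le c\,\|U\|\,\mathbf B(S)\,\|R\|$ for all Banach spaces $E_0,F_0$ and all $U\in\mathcal F(E_0,E)$, $S\in\mathcal B(F_0,E_0)$, $R\in\mathcal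 F(F,F_0)$, and $T\in\mathcal B^*$ if such a $c$ exists; - $\mathbf B^{\Delta}(T)$, for $T:E\to F$, is the infimum of all $c\ge 0$ with $|\mathrm{tr}(TL)|\le c\,\mathbf B(L)$ for all $L\in\mathcal F(F,E)$, and $T\in\mathcal B^\Delta$ if such a $c$ exists; - the *principle of $\mathcal B$-local reflexivity* holds if for all Banach spaces $M,F$ with $\dim M<\infty$, all finite-dimensional subspaces $N\subseteq F'$, all operators $T:M\to F''$ and all $\epsilon>0$ there is an operator $S:M\to F$ with $\mathbf B(S)\le(1+\epsilon)\,\mathbf B^{**}(T)$, with $\langle Sx,b\rangle=\langle b,Tx\rangle$ for all $(x,b)\in M\times N$, and with $j_FSx=Tx$ for all $x\in M$ such that $Tx\in j_F(F)$; - $\mathcal B$ is *totally accessible* if for all Banach spaces $E,F$, every $T\in\mathcal F(E,F)$ and every $\epsilon>0$ there are a closed subspace $K\subseteq E$ of finite codimension, a finite-dimensional subspace $N\subseteq F$ and $S\in\mathcal B(E/K,N)$ such that $T=J_N^F\,S\,Q_K^E$ (inclusion and quotient map) and $\mathbf B(S)\le(1+\epsilon)\,\mathbf B(T)$. Let $(\mathcal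 A,\mathbf A)$ be a Banach ideal. If the principle of $\mathcal A^{*}$-local reflexivity holds, then $\mathcal A^{inj}\circ\overline{\mathcal F}=(\mathcal A^{inj})^{min}$ (with equal norms), and this ideal is totally accessible. Moreover, for every finite operator $L$ between Banach spaces, $$(\mathbf A^{inj})^{min}(L)=(\mathbf A^{*\Delta})^{inj}(L)=(\mathbf A^{min})^{inj}(L)<\infty .$$ -/

import Mathlib

open scoped ENNReal NNReal

universe u

noncomputable section

namespace OpIdeal

/-- A class of bounded operators between Banach spaces, given by an extended gauge
`A.gauge T ∈ [0, ∞]`: the operator `T` belongs to the class if and only if its gauge is finite,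
and the gauge of `T` is then the ideal (quasi-)norm of `T`. -/
structure OperatorClass (𝕜 : Type) [RCLike 𝕜] where
  gauge : ∀ {E F : Type u} [NormedAddCommGroup E] [NormedSpace 𝕜 E] [CompleteSpace E]
    [NormedAddCommGroup F] [NormedSpace 𝕜 F] [CompleteSpace F], (E →L[𝕜] F) → ℝ≥0∞

variable {𝕜 : Type} [RCLike 𝕜]
variable {E F : Type u} [NormedAddCommGroup E] [NormedSpace 𝕜 E] [CompleteSpace E]
  [NormedAddCommGroup F] [NormedSpace 𝕜 F] [CompleteSpace F]

/-- `T` belongs to the class `A`. -/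
def OperatorClass.Mem (A : OperatorClass.{u} 𝕜) (T : E →L[𝕜] F) : Prop :=
  A.gauge T ≠ ∞

/-- Banach ideals: every component is a linear space, complete under the ideal norm; the ideal
property `A(R T S) ≤ ‖R‖ A(T) ‖S‖` holds; and the identity of the scalar field, that is of any
one-dimensional Banach space, has ideal norm `1`. -/
structure IsBanachIdeal (A : OperatorClass.{u} 𝕜) : Prop where
  gauge_id : ∀ (E : Type u) [NormedAddCommGroup E] [NormedSpace 𝕜 E] [CompleteSpace E],
    Module.finrank 𝕜 E = 1 → A.gauge (ContinuousLinearMap.id 𝕜 E) = 1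
  gauge_eq_zero : ∀ {E F : Type u} [NormedAddCommGroup E] [NormedSpace 𝕜 E] [CompleteSpace E]
    [NormedAddCommGroup F] [NormedSpace 𝕜 F] [CompleteSpace F] (T : E →L[𝕜] F),
    A.gauge T = 0 ↔ T = 0
  gauge_smul : ∀ {E F : Type u} [NormedAddCommGroup E] [NormedSpace 𝕜 E] [CompleteSpace E]
    [NormedAddCommGroup F] [NormedSpace 𝕜 F] [CompleteSpace F] (c : 𝕜) (T : E →L[𝕜] F),
    A.gauge (c • T) = ‖c‖ₑ * A.gauge T
  gauge_add_le : ∀ {E F : Type u} [NormedAddCommGroup E] [NormedSpace 𝕜 E] [CompleteSpace E]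
    [NormedAddCommGroup F] [NormedSpace 𝕜 F] [CompleteSpace F] (S T : E →L[𝕜] F),
    A.gauge (S + T) ≤ A.gauge S + A.gauge T
  gauge_comp_le : ∀ {D E F G : Type u}
    [NormedAddCommGroup D] [NormedSpace 𝕜 D] [CompleteSpace D]
    [NormedAddCommGroup E] [NormedSpace 𝕜 E] [CompleteSpace E]
    [NormedAddCommGroup F] [NormedSpace 𝕜 F] [CompleteSpace F]
    [NormedAddCommGroup G] [NormedSpace 𝕜 G] [CompleteSpace G]
    (R : F →L[𝕜] G) (T : E →L[𝕜] F) (S : D →L[𝕜] E),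
    A.gauge (R ∘L T ∘L S) ≤ ‖R‖ₑ * A.gauge T * ‖S‖ₑ
  complete : ∀ {E F : Type u} [NormedAddCommGroup E] [NormedSpace 𝕜 E] [CompleteSpace E]
    [NormedAddCommGroup F] [NormedSpace 𝕜 F] [CompleteSpace F] (T : ℕ → (E →L[𝕜] F)),
    (∀ n, A.Mem (T n)) →
    (∀ ε : ℝ≥0∞, 0 < ε → ∃ k, ∀ m ≥ k, ∀ n ≥ k, A.gauge (T m - T n) ≤ ε) →
    ∃ L : E →L[𝕜] F, A.Mem L ∧
      Filter.Tendsto (fun n => A.gauge (T n - L)) Filter.atTop (nhds 0)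

/-- Finite (that is, finite rank) operators. -/
def IsFiniteOp (T : E →L[𝕜] F) : Prop :=
  FiniteDimensional 𝕜 (LinearMap.range T.toLinearMap)

/-- The trace of a finite operator `T : E → E`: the trace of the restriction of `T` to its
(finite-dimensional) range. It is only used for finite operators. -/
def finTrace (T : E →L[𝕜] E) : 𝕜 :=
  LinearMap.trace 𝕜 (LinearMap.range T.toLinearMap)
    (T.toLinearMap.rangeRestrict ∘ₗ (LinearMap.range T.toLinearMap).subtype)

open Classical in
/-- The approximable operators, i.e. the limits of finite operators in the operator norm, with the
operator norm. -/
def approximable : OperatorClass.{u} 𝕜 where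
  gauge {E F} _ _ _ _ _ _ T :=
    if T ∈ closure {S : E →L[𝕜] F | IsFiniteOp S} then ‖T‖ₑ else ∞

/-- The product `A ∘ B`: operators `T = S R` with `R` in `B` and `S` in `A`, with the infimum of
`A(S) B(R)` over all such factorizations through Banach spaces `G`. -/
def OperatorClass.comp (A B : OperatorClass.{u} 𝕜) : OperatorClass.{u} 𝕜 where
  gauge {E F} _ _ _ _ _ _ T :=
    sInf {r : ℝ≥0∞ | ∃ (G : Type u) (_ : NormedAddCommGroup G) (_ : NormedSpace 𝕜 G)
      (_ : CompleteSpace G) (R : E →L[𝕜] G) (S : G →L[𝕜] F),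
      B.Mem R ∧ A.Mem S ∧ T = S ∘L R ∧ r = A.gauge S * B.gauge R}

/-- The minimal kernel `A^min`: the product `(approximable) ∘ A ∘ (approximable)`. -/
def OperatorClass.min (A : OperatorClass.{u} 𝕜) : OperatorClass.{u} 𝕜 :=
  (approximable.comp A).comp approximable

/-- The adjoint `A^*`: its norm at `T : E → F` is the infimum of all `c ≥ 0` such that
`|tr (T B S R)| ≤ c ‖B‖ A(S) ‖R‖` for all finite `B : E₀ → E`, all `S : F₀ → E₀` in `A` and all
finite `R : F → F₀`. -/
def OperatorClass.adjoint (A : OperatorClass.{u} 𝕜) : OperatorClass.{u} 𝕜 where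
  gauge {E F} _ _ _ _ _ _ T :=
    ⨅ (c : ℝ≥0) (_ : ∀ (E₀ F₀ : Type u)
        [NormedAddCommGroup E₀] [NormedSpace 𝕜 E₀] [CompleteSpace E₀]
        [NormedAddCommGroup F₀] [NormedSpace 𝕜 F₀] [CompleteSpace F₀]
        (B : E₀ →L[𝕜] E) (S : F₀ →L[𝕜] E₀) (R : F →L[𝕜] F₀),
        IsFiniteOp B → A.Mem S → IsFiniteOp R →
        ‖finTrace (T ∘L B ∘L S ∘L R)‖ₑ ≤ c * ‖B‖ₑ * A.gauge S * ‖R‖ₑ),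
      (c : ℝ≥0∞)

/-- The conjugate `A^Δ`: its norm at `T : E → F` is the infimum of all `c ≥ 0` such that
`|tr (T L)| ≤ c A(L)` for all finite operators `L : F → E`. -/
def OperatorClass.conjugate (A : OperatorClass.{u} 𝕜) : OperatorClass.{u} 𝕜 where
  gauge {E F} _ _ _ _ _ _ T :=
    ⨅ (c : ℝ≥0) (_ : ∀ L : F →L[𝕜] E, IsFiniteOp L →
        ‖finTrace (T ∘L L)‖ₑ ≤ c * A.gauge L),
      (c : ℝ≥0∞)

/-- The Banach space `F^∞ = ℓ^∞(B_{F'})` of bounded functions on the closed dual unit ball. -/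
abbrev LInftyDualBall (𝕜 : Type) [RCLike 𝕜] (F : Type u) [NormedAddCommGroup F]
    [NormedSpace 𝕜 F] : Type u :=
  lp (fun _ : Metric.closedBall (0 : StrongDual 𝕜 F) 1 => 𝕜) ∞

/-- The canonical metric injection `F → ℓ^∞(B_{F'})`, `y ↦ (φ y)_φ`. -/
def canonicalEmbedding (𝕜 : Type) [RCLike 𝕜] (F : Type u) [NormedAddCommGroup F]
    [NormedSpace 𝕜 F] : F →ₗᵢ[𝕜] LInftyDualBall 𝕜 F where
  toFun y := ⟨fun φ => φ.1 y, memℓp_infty ⟨‖y‖, by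
    rintro _ ⟨φ, rfl⟩
    have h : ‖φ.1‖ ≤ 1 := mem_closedBall_zero_iff.1 φ.2
    exact (φ.1.le_of_opNorm_le h y).trans_eq (one_mul _)⟩⟩
  map_add' x y := by ext φ; exact map_add φ.1 x y
  map_smul' c x := by ext φ; exact map_smul φ.1 c x
  norm_map' y := by
    refine le_antisymm (lp.norm_le_of_forall_le (norm_nonneg y) fun φ => ?_) ?_
    · have h : ‖φ.1‖ ≤ 1 := mem_closedBall_zero_iff.1 φ.2
      exact (φ.1.le_of_opNorm_le h y).trans_eq (one_mul _)
    · obtain ⟨g, hg, hgy⟩ := exists_dual_vector'' 𝕜 y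
      have h := lp.norm_apply_le_norm ENNReal.top_ne_zero
        (⟨fun φ => φ.1 y, memℓp_infty ⟨‖y‖, by
          rintro _ ⟨φ, rfl⟩
          have h : ‖φ.1‖ ≤ 1 := mem_closedBall_zero_iff.1 φ.2
          exact (φ.1.le_of_opNorm_le h y).trans_eq (one_mul _)⟩⟩ : LInftyDualBall 𝕜 F)
        ⟨g, mem_closedBall_zero_iff.2 hg⟩
      simpa [hgy] using h

/-- The injective hull `A^inj`: `A^inj(T) = A(J_F T)` for `T : E → F`, where `J_F` is the canonical
metric injection of `F` into `ℓ^∞(B_{F'})`. -/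
def OperatorClass.inj (A : OperatorClass.{u} 𝕜) : OperatorClass.{u} 𝕜 where
  gauge {_ F} _ _ _ _ _ _ T :=
    A.gauge ((canonicalEmbedding 𝕜 F).toContinuousLinearMap ∘L T)

/-- The principle of `A`-local reflexivity: for all Banach spaces `M`, `F` with `M`
finite-dimensional, every finite-dimensional subspace `N` of `F'`, every `T : M → F''` and every
`ε > 0` there is `S : M → F` with `A(S) ≤ (1 + ε) A^{**}(T)` such that `⟨S x, b⟩ = ⟨b, T x⟩` on
`M × N`, and `S` coincides with `T` wherever `T` takes values in (the canonical image of) `F`. -/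
def LocalReflexivity (A : OperatorClass.{u} 𝕜) : Prop :=
  ∀ (M F : Type u) [NormedAddCommGroup M] [NormedSpace 𝕜 M] [CompleteSpace M]
    [FiniteDimensional 𝕜 M]
    [NormedAddCommGroup F] [NormedSpace 𝕜 F] [CompleteSpace F]
    (T : M →L[𝕜] StrongDual 𝕜 (StrongDual 𝕜 F))
    (N : Submodule 𝕜 (StrongDual 𝕜 F)) [FiniteDimensional 𝕜 N] (ε : ℝ), 0 < ε →
    ∃ S : M →L[𝕜] F,
      A.gauge S ≤ ENNReal.ofReal (1 + ε) * A.adjoint.adjoint.gauge (E := M)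
        (F := StrongDual 𝕜 (StrongDual 𝕜 F)) T ∧
      (∀ x : M, ∀ b ∈ N, b (S x) = T x b) ∧
      (∀ x : M, T x ∈ Set.range (NormedSpace.inclusionInDoubleDual 𝕜 F) →
        NormedSpace.inclusionInDoubleDual 𝕜 F (S x) = T x)

/-- Total accessibility: every finite operator `T : E → F` factors, for every `ε > 0`, as
`T = J_N S Q_K` with `K ⊆ E` closed of finite codimension, `N ⊆ F` finite-dimensional, `S : E/K → N`
in `A` and `A(S) ≤ (1 + ε) A(T)`. -/
def TotallyAccessible (A : OperatorClass.{u} 𝕜) : Prop :=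
  ∀ (E F : Type u) [NormedAddCommGroup E] [NormedSpace 𝕜 E] [CompleteSpace E]
    [NormedAddCommGroup F] [NormedSpace 𝕜 F] [CompleteSpace F]
    (T : E →L[𝕜] F), IsFiniteOp T → ∀ ε : ℝ, 0 < ε →
    ∃ (K : Submodule 𝕜 E) (_ : IsClosed (K : Set E)) (_ : FiniteDimensional 𝕜 (E ⧸ K))
      (N : Submodule 𝕜 F) (_ : FiniteDimensional 𝕜 N) (S : (E ⧸ K) →L[𝕜] N),
      haveI : CompleteSpace N := FiniteDimensional.complete 𝕜 N
      T = N.subtypeL ∘L S ∘L K.mkQL ∧ A.Mem S ∧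
        A.gauge S ≤ ENNReal.ofReal (1 + ε) * A.gauge T

end OpIdeal

end

/-! For a finite operator the three norms are linked by a cycle of inequalities: `(A^inj)^min ≤
(A^{*Δ})^inj ≤ (A^min)^inj ≤ A^inj ∘ approximable ≤ (A^inj)^min`.

Three links are soft. The last holds because `A^inj` absorbs bounded left factors. The third uses a
sharp metric approximation property of `ℓ^∞`: a finite `P` with `‖P‖ ≤ 1 + ε` fixes the
finite-dimensional range of `J_F L`, so `P` can serve as the left approximable factor
(`min_inj_gauge_le_of_finite`). The second holds because the trace against a fixed finite operator
is continuous, so the inequality defining `A^*` passes from finite to approximable outer factors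
(`adjoint_conjugate_gauge_le_min`).

The first link needs local reflexivity (`factorGauge_le_conjugate`). Through `P`, the operator `J_F
L` becomes some `W : E → M` with `M` finite-dimensional. Take a Hahn–Banach functional `φ` norming
`W` for the cost of factoring through finite-dimensional spaces. Trace duality turns `φ` into `T : M
→ E''`, and an operator form of Helly's lemma (`exists_bidualComp_approx`) gives `A^{***}(T) ≤ 1`.
Local reflexivity replaces `T` by `S : M → E` with `A^*(S) ≤ 1 + ε` and `tr(W S) = φ(W)`. Testing
`J_F L` against `S P` bounds the factorization cost by its `A^{*Δ}`-norm. Injectivity then brings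
the factorization back from `ℓ^∞` to `F` (`exists_finite_factorization`), which also yields total
accessibility.

For a general product `S R` with `R` approximable, `R` is a rapidly convergent series of finite `P
n`. Each `S P n` is factored as above, and the pieces are glued in countable sup-norm sums
(`IsBanachIdeal.min_inj_gauge_le_of_hasSum`). -/

noncomputable section

namespace OpIdeal

/-! ### Traces and algebra of finite rank operators. -/

section Trace

variable {𝕜 : Type} [RCLike 𝕜]
variable {E F X : Type u} [NormedAddCommGroup E] [NormedSpace 𝕜 E]
  [NormedAddCommGroup F] [NormedSpace 𝕜 F]
  [NormedAddCommGroup X] [NormedSpace 𝕜 X]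

/-- Both traces live on subspaces linked by `range g`, so two applications of cyclicity suffice. It
lets `finTrace` be computed through any finite-dimensional factorization. -/
theorem trace_rangeRestrict_eq {V X : Type u} [AddCommGroup V] [Module 𝕜 V] [AddCommGroup X]
    [Module 𝕜 X] [FiniteDimensional 𝕜 X] (f : V →ₗ[𝕜] X) (g : X →ₗ[𝕜] V) :
    LinearMap.trace 𝕜 (LinearMap.range (g ∘ₗ f))
      ((g ∘ₗ f).rangeRestrict ∘ₗ (LinearMap.range (g ∘ₗ f)).subtype) =
    LinearMap.trace 𝕜 X (f ∘ₗ g) := by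
  have hle : LinearMap.range (g ∘ₗ f) ≤ LinearMap.range g := LinearMap.range_comp_le_range f g
  have : FiniteDimensional 𝕜 (LinearMap.range (g ∘ₗ f)) := Submodule.finiteDimensional_of_le hle
  set R := LinearMap.range (g ∘ₗ f)
  set V₀ := LinearMap.range g
  have e1 : f ∘ₗ g = (f ∘ₗ V₀.subtype) ∘ₗ g.rangeRestrict := by ext; rfl
  have e2 : g.rangeRestrict ∘ₗ (f ∘ₗ V₀.subtype) =
      Submodule.inclusion hle ∘ₗ ((g ∘ₗ f).rangeRestrict ∘ₗ V₀.subtype) := by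
    ext; rfl
  rw [e1, LinearMap.trace_comp_comm' g.rangeRestrict (f ∘ₗ V₀.subtype), e2,
    LinearMap.trace_comp_comm' _ (Submodule.inclusion hle)]
  rfl

theorem finTrace_eq_trace_comp [FiniteDimensional 𝕜 X] (f : E →L[𝕜] X) (g : X →L[𝕜] E) :
    finTrace (g ∘L f) = LinearMap.trace 𝕜 X (f.toLinearMap ∘ₗ g.toLinearMap) :=
  trace_rangeRestrict_eq f.toLinearMap g.toLinearMap

/-- The corestriction of an operator to its range. -/
def rangeRestrictL (T : E →L[𝕜] F) : E →L[𝕜] LinearMap.range T.toLinearMap :=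
  T.codRestrict _ fun x => ⟨x, rfl⟩

theorem subtypeL_comp_rangeRestrictL (T : E →L[𝕜] F) :
    (LinearMap.range T.toLinearMap).subtypeL ∘L rangeRestrictL T = T := by
  ext; rfl

theorem norm_rangeRestrictL_le (T : E →L[𝕜] F) : ‖rangeRestrictL T‖ ≤ ‖T‖ :=
  ContinuousLinearMap.opNorm_le_bound _ (norm_nonneg _) fun x => T.le_opNorm x

/-- Once `U` is factored through its range, both sides are traces of the same endomorphism of that
range. -/
theorem finTrace_comp_comm {U : E →L[𝕜] F} (hU : IsFiniteOp U) (V : F →L[𝕜] E) :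
    finTrace (V ∘L U) = finTrace (U ∘L V) := by
  have : FiniteDimensional 𝕜 (LinearMap.range U.toLinearMap) := hU
  set ι := (LinearMap.range U.toLinearMap).subtypeL
  have h : ι ∘L rangeRestrictL U = U := subtypeL_comp_rangeRestrictL U
  have e1 : V ∘L U = (V ∘L ι) ∘L rangeRestrictL U := by
    rw [ContinuousLinearMap.comp_assoc, h]
  have e2 : U ∘L V = ι ∘L (rangeRestrictL U ∘L V) := by
    rw [← ContinuousLinearMap.comp_assoc, h]
  rw [e1, e2, finTrace_eq_trace_comp, finTrace_eq_trace_comp]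
  rfl

theorem IsFiniteOp.of_factor [FiniteDimensional 𝕜 X] (f : E →L[𝕜] X) (g : X →L[𝕜] F) :
    IsFiniteOp (g ∘L f) :=
  Submodule.finiteDimensional_of_le (LinearMap.range_comp_le_range f.toLinearMap g.toLinearMap)

theorem IsFiniteOp.of_finiteDimensional_left [FiniteDimensional 𝕜 E] (T : E →L[𝕜] F) :
    IsFiniteOp T :=
  inferInstanceAs (FiniteDimensional 𝕜 (LinearMap.range T.toLinearMap))

theorem IsFiniteOp.of_finiteDimensional_right [FiniteDimensional 𝕜 F] (T : E →L[𝕜] F) :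
    IsFiniteOp T :=
  inferInstanceAs (FiniteDimensional 𝕜 (LinearMap.range T.toLinearMap))

theorem IsFiniteOp.comp_left {T : E →L[𝕜] F} (hT : IsFiniteOp T) (U : F →L[𝕜] X) :
    IsFiniteOp (U ∘L T) := by
  have : FiniteDimensional 𝕜 (LinearMap.range T.toLinearMap) := hT
  have := IsFiniteOp.of_factor (rangeRestrictL T) (U ∘L (LinearMap.range T.toLinearMap).subtypeL)
  rwa [ContinuousLinearMap.comp_assoc, subtypeL_comp_rangeRestrictL] at this

theorem IsFiniteOp.comp_right {T : E →L[𝕜] F} (hT : IsFiniteOp T) (U : X →L[𝕜] E) :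
    IsFiniteOp (T ∘L U) := by
  have : FiniteDimensional 𝕜 (LinearMap.range T.toLinearMap) := hT
  have := IsFiniteOp.of_factor (rangeRestrictL T ∘L U) (LinearMap.range T.toLinearMap).subtypeL
  rwa [← ContinuousLinearMap.comp_assoc, subtypeL_comp_rangeRestrictL] at this

theorem IsFiniteOp.add {S T : E →L[𝕜] F} (hS : IsFiniteOp S) (hT : IsFiniteOp T) :
    IsFiniteOp (S + T) := by
  have : FiniteDimensional 𝕜 (LinearMap.range S.toLinearMap) := hS
  have : FiniteDimensional 𝕜 (LinearMap.range T.toLinearMap) := hT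
  exact Submodule.finiteDimensional_of_le (LinearMap.range_add_le S.toLinearMap T.toLinearMap)

theorem IsFiniteOp.neg {T : E →L[𝕜] F} (hT : IsFiniteOp T) : IsFiniteOp (-T) := by
  have := hT.comp_left (-(ContinuousLinearMap.id 𝕜 F))
  convert this using 1
  ext; simp

theorem isFiniteOp_zero : IsFiniteOp (0 : E →L[𝕜] F) := by
  have : LinearMap.range (0 : E →L[𝕜] F).toLinearMap = ⊥ := by simp
  unfold IsFiniteOp
  rw [this]
  infer_instance

/-- The additive group of finite operators. -/
def finiteOps (𝕜 : Type) [RCLike 𝕜] (E F : Type u) [NormedAddCommGroup E] [NormedSpace 𝕜 E]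
    [NormedAddCommGroup F] [NormedSpace 𝕜 F] : AddSubgroup (E →L[𝕜] F) where
  carrier := {T | IsFiniteOp T}
  zero_mem' := isFiniteOp_zero
  add_mem' := fun h h' => h.add h'
  neg_mem' := fun h => h.neg

end Trace

/-! ### Norming functionals for `ℝ≥0∞`-valued seminorms. -/

section HahnBanach

variable {𝕜 : Type} [RCLike 𝕜]

/-- The seminorm given by a finite subadditive and homogeneous `ℝ≥0∞`-valued functional. -/
def seminormOfENNReal {V : Type*} [AddCommGroup V] [Module 𝕜 V] (q : V → ℝ≥0∞)
    (hfin : ∀ v, q v ≠ ∞) (hadd : ∀ v w, q (v + w) ≤ q v + q w)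
    (hsmul : ∀ (c : 𝕜) v, q (c • v) ≤ ‖c‖ₑ * q v) : Seminorm 𝕜 V :=
  Seminorm.ofSMulLE (fun v => (q v).toReal)
    (by
      have := hsmul 0 (0 : V)
      simp only [smul_zero, enorm_zero, zero_mul, nonpos_iff_eq_zero] at this
      simp [this])
    (fun v w => by
      rw [← ENNReal.toReal_add (hfin v) (hfin w)]
      exact ENNReal.toReal_mono (by simp [hfin]) (hadd v w))
    (fun c v => by
      have := ENNReal.toReal_mono (ENNReal.mul_ne_top (by simp) (hfin v)) (hsmul c v)
      simpa [ENNReal.toReal_mul] using this)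

theorem exists_dual_enorm_le {V : Type*} [AddCommGroup V] [Module 𝕜 V] (q : V → ℝ≥0∞)
    (hfin : ∀ v, q v ≠ ∞) (hadd : ∀ v w, q (v + w) ≤ q v + q w)
    (hsmul : ∀ (c : 𝕜) v, q (c • v) ≤ ‖c‖ₑ * q v) (v : V) :
    ∃ φ : V →ₗ[𝕜] 𝕜, (∀ w, ‖φ w‖ₑ ≤ q w) ∧ ‖φ v‖ₑ = q v := by
  set p := seminormOfENNReal q hfin hadd hsmul
  have hp : ∀ w, p w = (q w).toReal := fun w => rfl
  obtain ⟨f, hf, hfv⟩ : ∃ f : Module.Dual 𝕜 V, (∀ w, ‖f w‖ ≤ p w) ∧ ‖f v‖ = p v := by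
    -- A vanishing value is settled by the zero functional; otherwise `v ≠ 0`, and `c • v ↦ p v * c`
    -- is extended from the line through `v`.
    by_cases hv : p v = 0
    · exact ⟨0, fun w => by simp, by simp [hv]⟩
    · have hv0 : v ≠ 0 := by rintro rfl; exact hv (map_zero p)
      set e := LinearEquiv.toSpanNonzeroSingleton 𝕜 V v hv0
      let g : Module.Dual 𝕜 (Submodule.span 𝕜 {v}) := ((p v : 𝕜)) • e.symm.toLinearMap
      have hg : ∀ c : 𝕜, g (e c) = (p v : 𝕜) * c := fun c => by simp [g, RCLike.real_smul_eq_coe_mul]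
      obtain ⟨f, hf, hfp⟩ := Module.Dual.exists_extension_of_le_seminorm (p := p)
        (Submodule.span 𝕜 {v}) g (fun x => by
          obtain ⟨c, rfl⟩ := e.surjective x
          rw [hg, norm_mul, RCLike.norm_ofReal, abs_of_nonneg (apply_nonneg p v), mul_comm]
          have : ((e c : Submodule.span 𝕜 {v}) : V) = c • v := rfl
          rw [this, map_smul_eq_mul])
      refine ⟨f, hfp, ?_⟩
      have h1 := hf (e 1)
      have h2 : ((e 1 : Submodule.span 𝕜 {v}) : V) = v := by
        change (1 : 𝕜) • v = v
        simp
      rw [h2, hg, mul_one] at h1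
      rw [h1, RCLike.norm_ofReal, abs_of_nonneg (apply_nonneg p v)]
  refine ⟨f, fun w => ?_, ?_⟩
  · rw [← ofReal_norm, ← ENNReal.ofReal_toReal (hfin w)]
    exact ENNReal.ofReal_le_ofReal (hf w)
  · rw [← ofReal_norm, hfv, hp, ENNReal.ofReal_toReal (hfin v)]

end HahnBanach

/-! ### Extension and approximation properties of `ℓ^∞`. -/

section LInfty

variable {𝕜 : Type} [RCLike 𝕜]

/-- Norm preserving extension of operators with values in `ℓ^∞`. -/
theorem exists_extension_linfty {Γ : Type*} {G H : Type*} [NormedAddCommGroup G]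
    [NormedSpace 𝕜 G] [NormedAddCommGroup H] [NormedSpace 𝕜 H] (i : G →ₗᵢ[𝕜] H)
    (U : G →L[𝕜] lp (fun _ : Γ => 𝕜) ∞) :
    ∃ V : H →L[𝕜] lp (fun _ : Γ => 𝕜) ∞, V ∘L i.toContinuousLinearMap = U ∧ ‖V‖ ≤ ‖U‖ := by
  have key : ∀ γ : Γ, ∃ g : StrongDual 𝕜 H, (∀ x, g (i x) = U x γ) ∧ ‖g‖ ≤ ‖U‖ := by
    intro γ
    let f : StrongDual 𝕜 (LinearMap.range i.toLinearMap) :=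
      (lp.evalCLM 𝕜 (fun _ : Γ => 𝕜) ∞ γ ∘L U) ∘L
        (i.equivRange.symm.toContinuousLinearEquiv : LinearMap.range i.toLinearMap →L[𝕜] G)
    have hfx : ∀ x, f (i.equivRange x) = U x γ := fun x => by
      change U (i.equivRange.symm (i.equivRange x)) γ = _
      simp
    have hf : ‖f‖ ≤ ‖U‖ := by
      refine ContinuousLinearMap.opNorm_le_bound _ (norm_nonneg _) fun y => ?_
      obtain ⟨x, rfl⟩ := i.equivRange.surjective y
      rw [hfx, LinearIsometryEquiv.norm_map]
      exact (lp.norm_apply_le_norm ENNReal.top_ne_zero (U x) γ).trans (U.le_opNorm x)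
    obtain ⟨g, hg, hgn⟩ := exists_extension_norm_eq _ f
    exact ⟨g, fun x => by rw [← hfx, ← hg]; rfl, hgn.le.trans hf⟩
  choose g hg hgn using key
  have bound : ∀ y γ, ‖g γ y‖ ≤ ‖U‖ * ‖y‖ := fun y γ => (g γ).le_of_opNorm_le (hgn γ) y
  let V₀ : H →ₗ[𝕜] lp (fun _ : Γ => 𝕜) ∞ :=
    { toFun := fun y => ⟨fun γ => g γ y, memℓp_infty ⟨‖U‖ * ‖y‖, by
        rintro _ ⟨γ, rfl⟩
        exact bound y γ⟩⟩
      map_add' := fun x y => by ext γ; exact map_add (g γ) x y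
      map_smul' := fun c x => by ext γ; exact map_smul (g γ) c x }
  have hV : ∀ y, ‖V₀ y‖ ≤ ‖U‖ * ‖y‖ := fun y =>
    lp.norm_le_of_forall_le (by positivity) fun γ => bound y γ
  refine ⟨V₀.mkContinuous _ hV, ?_, LinearMap.mkContinuous_norm_le _ (norm_nonneg _) hV⟩
  ext x γ
  exact hg γ x

/-- The dual unit ball of `X` is compact. The net is taken inside the family `ev` itself, so that
approximation amounts to sampling at finitely many indices. -/
theorem exists_finset_approx {X : Type*} [NormedAddCommGroup X] [NormedSpace 𝕜 X]
    [FiniteDimensional 𝕜 X] {Γ : Type*} (ev : Γ → StrongDual 𝕜 X) (hev : ∀ γ, ‖ev γ‖ ≤ 1)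
    {δ : ℝ} (hδ : 0 < δ) :
    ∃ (t : Set Γ) (_ : Finite t) (g : Γ → t), ∀ γ, ‖ev γ - ev (g γ)‖ < δ := by
  have htb : TotallyBounded (Set.range ev) := by
    have := FiniteDimensional.proper 𝕜 (StrongDual 𝕜 X)
    refine (isCompact_closedBall (0 : StrongDual 𝕜 X) 1).totallyBounded.subset ?_
    rintro _ ⟨γ, rfl⟩
    simpa using hev γ
  obtain ⟨t, hts, htf, hcov⟩ := htb.exists_subset (Metric.dist_mem_uniformity hδ)
  have hrep : ∀ y : t, ∃ γ, ev γ = y := fun y => hts y.2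
  choose r hr using hrep
  have hg : ∀ γ, ∃ y : Set.range r, ‖ev γ - ev y‖ < δ := by
    intro γ
    obtain ⟨y, hy, hd⟩ := Set.mem_iUnion₂.1 (hcov ⟨γ, rfl⟩)
    exact ⟨⟨r ⟨y, hy⟩, ⟨y, hy⟩, rfl⟩, by simpa [dist_eq_norm, hr] using hd⟩
  choose g hg using hg
  have := htf.to_subtype
  exact ⟨Set.range r, inferInstance, g, hg⟩

theorem exists_finite_norm_sub_le {Γ : Type u} (X : Submodule 𝕜 (lp (fun _ : Γ => 𝕜) ∞))
    [FiniteDimensional 𝕜 X] {δ : ℝ} (hδ : 0 < δ) :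
    ∃ P : lp (fun _ : Γ => 𝕜) ∞ →L[𝕜] lp (fun _ : Γ => 𝕜) ∞, IsFiniteOp P ∧ ‖P‖ ≤ 1 ∧
      ∀ x ∈ X, ‖x - P x‖ ≤ δ * ‖x‖ := by
  let ev : Γ → StrongDual 𝕜 X := fun γ => lp.evalCLM 𝕜 (fun _ : Γ => 𝕜) ∞ γ ∘L X.subtypeL
  have hev : ∀ γ, ‖ev γ‖ ≤ 1 := fun γ => ContinuousLinearMap.opNorm_le_bound _ zero_le_one
    fun x => by
      rw [one_mul]
      exact lp.norm_apply_le_norm ENNReal.top_ne_zero (x : lp (fun _ : Γ => 𝕜) ∞) γ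
  obtain ⟨t, ht, g, hg⟩ := exists_finset_approx ev hev hδ
  have := Fintype.ofFinite t
  -- `f₂ ∘L f₁` samples `x` at the indices in `t` and spreads the value at `g γ` to every `γ`
  -- represented by it.
  let f₁ : lp (fun _ : Γ => 𝕜) ∞ →L[𝕜] (t → 𝕜) :=
    ContinuousLinearMap.pi fun y => lp.evalCLM 𝕜 (fun _ : Γ => 𝕜) ∞ (y : Γ)
  let f₂' : (t → 𝕜) →ₗ[𝕜] lp (fun _ : Γ => 𝕜) ∞ :=
    { toFun := fun a => ⟨fun γ => a (g γ), memℓp_infty ⟨‖a‖, by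
        rintro _ ⟨γ, rfl⟩
        exact norm_le_pi_norm a _⟩⟩
      map_add' := fun x y => rfl
      map_smul' := fun c x => rfl }
  have hf₂ : ∀ a, ‖f₂' a‖ ≤ 1 * ‖a‖ := fun a => by
    rw [one_mul]
    exact lp.norm_le_of_forall_le (norm_nonneg _) fun γ => norm_le_pi_norm a (g γ)
  let f₂ := f₂'.mkContinuous 1 hf₂
  have happ : ∀ x γ, (f₂ ∘L f₁) x γ = x (g γ) := fun x γ => rfl
  refine ⟨f₂ ∘L f₁, ?_, ?_, ?_⟩
  · exact Submodule.finiteDimensional_of_le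
      (LinearMap.range_comp_le_range f₁.toLinearMap f₂.toLinearMap)
  · refine ContinuousLinearMap.opNorm_le_bound _ zero_le_one fun x => ?_
    rw [one_mul]
    refine lp.norm_le_of_forall_le (norm_nonneg _) fun γ => ?_
    rw [happ]
    exact lp.norm_apply_le_norm ENNReal.top_ne_zero x _
  · intro x hx
    refine lp.norm_le_of_forall_le (by positivity) fun γ => ?_
    have h1 : (x - (f₂ ∘L f₁) x) γ = (ev γ - ev (g γ)) ⟨x, hx⟩ := rfl
    rw [h1]
    exact (ContinuousLinearMap.le_opNorm _ _).trans
      (mul_le_mul_of_nonneg_right (hg γ).le (norm_nonneg _))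

/-- With `q` a projection onto `X`, the correction `(1 - P₀) q` makes `P₀` exact on `X` and costs at
most `δ * ‖q‖`. -/
theorem exists_finite_fixing_of_approx {Y : Type u} [NormedAddCommGroup Y] [NormedSpace 𝕜 Y]
    (X : Submodule 𝕜 Y) [FiniteDimensional 𝕜 X]
    (h : ∀ δ : ℝ, 0 < δ → ∃ P : Y →L[𝕜] Y, IsFiniteOp P ∧ ‖P‖ ≤ 1 ∧
      ∀ x ∈ X, ‖x - P x‖ ≤ δ * ‖x‖) {ε : ℝ} (hε : 0 < ε) :
    ∃ P : Y →L[𝕜] Y, IsFiniteOp P ∧ ‖P‖ ≤ 1 + ε ∧ ∀ x ∈ X, P x = x := by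
  obtain ⟨q, hq⟩ := Submodule.ClosedComplemented.of_finiteDimensional X
  have hδ : 0 < ε / (‖q‖ + 1) := by positivity
  obtain ⟨P₀, hP₀, hP₀n, hP₀X⟩ := h _ hδ
  set D : Y →L[𝕜] Y := ((ContinuousLinearMap.id 𝕜 _ - P₀) ∘L X.subtypeL) ∘L q
  have h1 : ∀ x, D x = (q x : Y) - P₀ (q x) := fun x => rfl
  refine ⟨P₀ + D, hP₀.add (IsFiniteOp.of_factor q _), ?_, ?_⟩
  · refine (norm_add_le _ _).trans (add_le_add hP₀n ?_)
    refine ContinuousLinearMap.opNorm_le_bound _ hε.le fun x => ?_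
    rw [h1]
    calc _ ≤ ε / (‖q‖ + 1) * ‖q x‖ := hP₀X _ (q x).2
      _ ≤ ε / (‖q‖ + 1) * (‖q‖ * ‖x‖) := by gcongr; exact q.le_opNorm x
      _ ≤ ε / (‖q‖ + 1) * ((‖q‖ + 1) * ‖x‖) := by gcongr; linarith
      _ = ε * ‖x‖ := by field_simp
  · intro x hx
    have h2 : (q x : Y) = x := congrArg Subtype.val (hq ⟨x, hx⟩)
    rw [add_apply, h1, h2]
    abel

/-- The metric approximation property of `ℓ^∞`, with exact reproduction of a given
finite-dimensional subspace. -/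
theorem exists_finite_fixing_linfty {Γ : Type u} (X : Submodule 𝕜 (lp (fun _ : Γ => 𝕜) ∞))
    [FiniteDimensional 𝕜 X] {ε : ℝ} (hε : 0 < ε) :
    ∃ P : lp (fun _ : Γ => 𝕜) ∞ →L[𝕜] lp (fun _ : Γ => 𝕜) ∞, IsFiniteOp P ∧ ‖P‖ ≤ 1 + ε ∧
      ∀ x ∈ X, P x = x :=
  exists_finite_fixing_of_approx X (fun _ hδ => exists_finite_norm_sub_le X hδ) hε

end LInfty

/-! ### Biadjoints into finite-dimensional spaces and Helly's lemma for operators. -/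

section Bidual

variable {𝕜 : Type} [RCLike 𝕜]
variable {E M X : Type u} [NormedAddCommGroup E] [NormedSpace 𝕜 E]
  [NormedAddCommGroup M] [NormedSpace 𝕜 M]
  [NormedAddCommGroup X] [NormedSpace 𝕜 X] [FiniteDimensional 𝕜 X]

variable (𝕜 X) in
/-- The coordinate functionals of the chosen basis of a finite-dimensional space. -/
def coordL (i : Fin (Module.finrank 𝕜 X)) : StrongDual 𝕜 X :=
  LinearMap.toContinuousLinearMap ((Module.finBasis 𝕜 X).coord i)

theorem sum_coordL_smul (x : X) : ∑ i, coordL 𝕜 X i x • Module.finBasis 𝕜 X i = x :=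
  (Module.finBasis 𝕜 X).sum_repr x

theorem coordL_finBasis (i j : Fin (Module.finrank 𝕜 X)) :
    coordL 𝕜 X i (Module.finBasis 𝕜 X j) = if j = i then 1 else 0 := by
  change (Module.finBasis 𝕜 X).repr (Module.finBasis 𝕜 X j) i = _
  rw [Module.Basis.repr_self, Finsupp.single_apply]

theorem ext_coordL {x y : X} (h : ∀ i, coordL 𝕜 X i x = coordL 𝕜 X i y) : x = y := by
  rw [← sum_coordL_smul (𝕜 := 𝕜) x, ← sum_coordL_smul (𝕜 := 𝕜) y]
  simp only [h]

theorem sum_smulRight_coordL (W : E →L[𝕜] X) :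
    ∑ i, (coordL 𝕜 X i ∘L W).smulRight (Module.finBasis 𝕜 X i) = W := by
  ext x
  simpa using sum_coordL_smul (𝕜 := 𝕜) (W x)

theorem sum_apply_coordL (ψ : StrongDual 𝕜 X) :
    ∑ i, ψ (Module.finBasis 𝕜 X i) • coordL 𝕜 X i = ψ := by
  ext x
  conv_rhs => rw [← sum_coordL_smul (𝕜 := 𝕜) x]
  simp [mul_comm]

theorem trace_eq_sum_coordL (D : X →ₗ[𝕜] X) :
    LinearMap.trace 𝕜 X D = ∑ i, coordL 𝕜 X i (D (Module.finBasis 𝕜 X i)) := by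
  rw [LinearMap.trace_eq_matrix_trace 𝕜 (Module.finBasis 𝕜 X)]
  simp [Matrix.trace, LinearMap.toMatrix_apply, coordL]

/-- The composition of the biadjoint of `W : E → X` with `T : M → E''`, for `X` of finite
dimension. -/
def bidualComp (T : M →L[𝕜] StrongDual 𝕜 (StrongDual 𝕜 E)) :
    (E →L[𝕜] X) →ₗ[𝕜] (M →L[𝕜] X) where
  toFun W := ∑ i, (T.flip (coordL 𝕜 X i ∘L W)).smulRight (Module.finBasis 𝕜 X i)
  map_add' V W := by
    ext m
    simp [add_smul, Finset.sum_add_distrib]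
  map_smul' c W := by
    ext m
    simp [mul_smul, Finset.smul_sum]

/-- Expanding `ψ` in coordinates shows that `bidualComp` does not depend on the basis in its
definition: it is `W'' T`. -/
theorem dual_bidualComp (T : M →L[𝕜] StrongDual 𝕜 (StrongDual 𝕜 E)) (W : E →L[𝕜] X)
    (ψ : StrongDual 𝕜 X) (m : M) : ψ (bidualComp T W m) = T m (ψ ∘L W) := by
  have h : ψ ∘L W = ∑ i, ψ (Module.finBasis 𝕜 X i) • (coordL 𝕜 X i ∘L W) := by
    conv_lhs => rw [← sum_apply_coordL ψ]
    ext x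
    simp
  rw [h]
  simp [bidualComp, mul_comm]

theorem bidualComp_comp {Z : Type u} [NormedAddCommGroup Z] [NormedSpace 𝕜 Z]
    [FiniteDimensional 𝕜 Z] (T : M →L[𝕜] StrongDual 𝕜 (StrongDual 𝕜 E)) (W : E →L[𝕜] X)
    (V : X →L[𝕜] Z) : bidualComp T (V ∘L W) = V ∘L bidualComp T W := by
  ext m
  refine ext_coordL (𝕜 := 𝕜) fun i => ?_
  rw [dual_bidualComp, ← ContinuousLinearMap.comp_assoc, ← dual_bidualComp]
  rfl

theorem bidualComp_smulRight (T : M →L[𝕜] StrongDual 𝕜 (StrongDual 𝕜 E)) (b : StrongDual 𝕜 E)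
    (x : X) (m : M) : bidualComp T (b.smulRight x) m = T m b • x := by
  refine ext_coordL (𝕜 := 𝕜) fun i => ?_
  have h : coordL 𝕜 X i ∘L b.smulRight x = coordL 𝕜 X i x • b := by
    ext y
    simp [mul_comm]
  rw [dual_bidualComp, h]
  simp [mul_comm]

/-- Functionals on `L(E, M)`, `M` of finite dimension, are given by trace duality. -/
theorem eq_trace_bidualComp [FiniteDimensional 𝕜 M]
    (T : M →L[𝕜] StrongDual 𝕜 (StrongDual 𝕜 E))
    (φ : (E →L[𝕜] M) →ₗ[𝕜] 𝕜) (h : ∀ m b, T m b = φ (b.smulRight m)) (W : E →L[𝕜] M) :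
    φ W = LinearMap.trace 𝕜 M (bidualComp T W).toLinearMap := by
  rw [trace_eq_sum_coordL]
  conv_lhs => rw [← sum_smulRight_coordL W, map_sum]
  refine Finset.sum_congr rfl fun i _ => ?_
  rw [ContinuousLinearMap.coe_coe, dual_bidualComp, h]

/-- A finite set of functionals that is norming up to `ε`. -/
theorem exists_finite_norming {ε : ℝ} (hε : 0 < ε) :
    ∃ (ι : Type u) (_ : Fintype ι) (φ : ι → StrongDual 𝕜 X), (∀ i, ‖φ i‖ ≤ 1) ∧
      ∀ (y : X) (r : ℝ), 0 ≤ r → (∀ i, ‖φ i y‖ ≤ r) → ‖y‖ ≤ (1 + ε) * r := by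
  have hδ : 0 < ε / (1 + ε) := by positivity
  let ev : Metric.closedBall (0 : StrongDual 𝕜 X) 1 → StrongDual 𝕜 X := Subtype.val
  have hev : ∀ f, ‖ev f‖ ≤ 1 := fun f => mem_closedBall_zero_iff.1 f.2
  obtain ⟨t, ht, g, hg⟩ := exists_finset_approx ev hev hδ
  refine ⟨t, Fintype.ofFinite t, fun i => ev i, fun i => hev i, fun y r hr hy => ?_⟩
  obtain ⟨f, hf, hfy⟩ := exists_dual_vector'' 𝕜 y
  set f' : Metric.closedBall (0 : StrongDual 𝕜 X) 1 := ⟨f, mem_closedBall_zero_iff.2 hf⟩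
  have h1 : ‖y‖ = ‖f y‖ := by rw [hfy]; simp
  have h2 : f y = ev (g f') y + (ev f' - ev (g f')) y := by simp [ev, f']
  have h3 : ‖y‖ ≤ r + ε / (1 + ε) * ‖y‖ := by
    conv_lhs => rw [h1, h2]
    exact (norm_add_le _ _).trans (add_le_add (hy _)
      (ContinuousLinearMap.le_of_opNorm_le _ (hg f').le y))
  have h4 : ‖y‖ = (1 + ε) * (‖y‖ - ε / (1 + ε) * ‖y‖) := by field_simp; ring
  rw [h4]
  gcongr
  linarith

/-- The dual of a finite sup-norm power carries the `ℓ¹`-norm: choose almost norming vectors,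
rotated so that the values `x i (e i)` are nonnegative and add up without cancellation. -/
theorem sum_norm_le_of_pi_bound {ι Z : Type*} [Fintype ι] [NormedAddCommGroup Z]
    [NormedSpace 𝕜 Z] (x : ι → StrongDual 𝕜 Z) {c : ℝ} (hc : 0 ≤ c)
    (h : ∀ v : ι → Z, ‖∑ i, x i (v i)‖ ≤ c * ‖v‖) : ∑ i, ‖x i‖ ≤ c := by
  refine le_of_forall_pos_le_add fun η hη => ?_
  have hη' : 0 < η / (Fintype.card ι + 1) := by positivity
  have key : ∀ i, ∃ e : Z, ‖e‖ ≤ 1 ∧ x i e = (‖x i e‖ : 𝕜) ∧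
      ‖x i‖ ≤ ‖x i e‖ + η / (Fintype.card ι + 1) := by
    intro i
    obtain ⟨e, he, hxe⟩ := (x i).exists_lt_apply_of_lt_opNorm (sub_lt_self ‖x i‖ hη')
    obtain ⟨u, hu, hue⟩ := RCLike.exists_norm_eq_mul_self (x i e)
    refine ⟨u • e, by rw [norm_smul, hu, one_mul]; exact he.le, ?_, ?_⟩
    · rw [map_smul, smul_eq_mul, ← hue]
      simp
    · rw [map_smul, norm_smul, hu, one_mul]
      linarith
  choose e he hxe hle using key
  have h1 : ∑ i, x i (e i) = ((∑ i, ‖x i (e i)‖ : ℝ) : 𝕜) := by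
    rw [RCLike.ofReal_sum]
    exact Finset.sum_congr rfl fun i _ => hxe i
  have h2 := h e
  rw [h1, RCLike.norm_ofReal, abs_of_nonneg (Finset.sum_nonneg fun i _ => norm_nonneg _)] at h2
  have h3 : ‖e‖ ≤ 1 := (pi_norm_le_iff_of_nonneg zero_le_one).2 he
  calc ∑ i, ‖x i‖ ≤ ∑ i, (‖x i (e i)‖ + η / (Fintype.card ι + 1)) :=
        Finset.sum_le_sum fun i _ => hle i
    _ = ∑ i, ‖x i (e i)‖ + Fintype.card ι * (η / (Fintype.card ι + 1)) := by
        simp [Finset.sum_add_distrib]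
    _ ≤ c + η := by
        refine add_le_add (h2.trans (mul_le_of_le_one_right hc h3)) ?_
        rw [← mul_div_assoc, div_le_iff₀ (by positivity)]
        nlinarith

/-- A functional on `L(E, X)` of norm at most `1`, with `X` of finite dimension, is given by an
element of `X' ⊗ E''` of projective norm at most `1 + ε`. -/
theorem exists_repr_functional (g : (E →L[𝕜] X) →ₗ[𝕜] 𝕜) (hg : ∀ W, ‖g W‖ ≤ ‖W‖) {ε : ℝ}
    (hε : 0 < ε) :
    ∃ (ι : Type u) (_ : Fintype ι) (φ : ι → StrongDual 𝕜 X)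
      (x : ι → StrongDual 𝕜 (StrongDual 𝕜 E)), (∀ i, ‖φ i‖ ≤ 1) ∧ ∑ i, ‖x i‖ ≤ 1 + ε ∧
        ∀ W, g W = ∑ i, x i (φ i ∘L W) := by
  classical
  obtain ⟨ι, _, φ, hφ, hnorm⟩ := exists_finite_norming (𝕜 := 𝕜) (X := X) hε
  -- `Φ` embeds `L(E, X)` into a finite sup-norm power of `E'` at the cost of a factor `1 + ε`. A
  -- Hahn–Banach extension of `g` to that power splits into elements of `E''`.
  let Φ : (E →L[𝕜] X) →ₗ[𝕜] (ι → StrongDual 𝕜 E) :=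
    { toFun := fun W i => φ i ∘L W
      map_add' := fun V W => by ext; simp
      map_smul' := fun c W => by ext; simp }
  have hΦ : ∀ W, ‖W‖ ≤ (1 + ε) * ‖Φ W‖ := fun W => by
    refine ContinuousLinearMap.opNorm_le_bound _ (by positivity) fun y => ?_
    rw [mul_assoc]
    refine hnorm _ _ (by positivity) fun i => ?_
    exact (φ i ∘L W).le_of_opNorm_le (norm_le_pi_norm (Φ W) i) y
  have hinj : Function.Injective Φ := by
    rw [← LinearMap.ker_eq_bot, LinearMap.ker_eq_bot']
    intro W hW
    have := hΦ W
    rw [hW, norm_zero, mul_zero] at this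
    exact norm_le_zero_iff.1 this
  let e := LinearEquiv.ofInjective Φ hinj
  let c : ℝ≥0 := ⟨1 + ε, by positivity⟩
  let p : Seminorm 𝕜 (ι → StrongDual 𝕜 E) := c • normSeminorm 𝕜 (ι → StrongDual 𝕜 E)
  have hp : ∀ v, p v = (1 + ε) * ‖v‖ := fun v => rfl
  obtain ⟨G, hG, hGp⟩ := Module.Dual.exists_extension_of_le_seminorm (p := p)
    (LinearMap.range Φ) (g ∘ₗ e.symm.toLinearMap) (fun v => by
      obtain ⟨W, rfl⟩ := e.surjective v
      rw [hp, LinearMap.comp_apply, LinearEquiv.coe_coe, LinearEquiv.symm_apply_apply]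
      exact (hg W).trans (hΦ W))
  have hx : ∀ i (b : StrongDual 𝕜 E), ‖(G ∘ₗ LinearMap.single 𝕜 _ i) b‖ ≤ (1 + ε) * ‖b‖ :=
    fun i b => (hGp _).trans_eq (by rw [hp, LinearMap.single_apply, Pi.norm_single])
  let x : ι → StrongDual 𝕜 (StrongDual 𝕜 E) := fun i =>
    (G ∘ₗ LinearMap.single 𝕜 _ i).mkContinuous (1 + ε) (hx i)
  have hxG : ∀ v, G v = ∑ i, x i (v i) := fun v => by
    conv_lhs => rw [← Finset.univ_sum_single v, map_sum]
    rfl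
  refine ⟨ι, inferInstance, φ, x, hφ, sum_norm_le_of_pi_bound x (by positivity) fun v => ?_,
    fun W => ?_⟩
  · rw [← hxG]
    exact hGp v
  · have h1 := hG (e W)
    have h2 : ((e W : LinearMap.range Φ) : ι → StrongDual 𝕜 E) = Φ W := rfl
    rw [h2, hxG] at h1
    simpa [Φ] using h1.symm

/-- `B` identifies the normed space `Z` with the bidual of `E`. -/
structure IsBidual {Z : Type u} [NormedAddCommGroup Z] [NormedSpace 𝕜 Z]
    (B : Z →L[𝕜] StrongDual 𝕜 (StrongDual 𝕜 E)) : Prop where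
  injective : Function.Injective B
  exists_eq : ∀ x, ∃ z, B z = x ∧ ‖z‖ ≤ ‖x‖

variable {Z : Type u} [NormedAddCommGroup Z] [NormedSpace 𝕜 Z]
  {B : Z →L[𝕜] StrongDual 𝕜 (StrongDual 𝕜 E)}

/-- The dual form of Helly's lemma. The functional `W ↦ φ (W'' T)` is given by a tensor `∑ ψ i ⊗ x
i` of projective norm close to `1`, and the same tensor evaluated at `R` computes `φ (R T)`. -/
theorem norm_functional_comp_le [FiniteDimensional 𝕜 M] (hB : IsBidual B)
    (T : M →L[𝕜] Z) (φ : (M →L[𝕜] X) →ₗ[𝕜] 𝕜)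
    (hφ : ∀ W : E →L[𝕜] X, ‖φ (bidualComp (B ∘L T) W)‖ ≤ ‖W‖)
    (R : Z →L[𝕜] X) : ‖φ (R ∘L T)‖ ≤ ‖R‖ := by
  let m : Fin (Module.finrank 𝕜 X) → M := fun j =>
    ∑ k, φ ((coordL 𝕜 M k).smulRight (Module.finBasis 𝕜 X j)) • Module.finBasis 𝕜 M k
  have hm : ∀ D : M →L[𝕜] X, φ D = ∑ j, coordL 𝕜 X j (D (m j)) := by
    intro D
    have h1 : D = ∑ j, ∑ k, coordL 𝕜 X j (D (Module.finBasis 𝕜 M k)) •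
        (coordL 𝕜 M k).smulRight (Module.finBasis 𝕜 X j) := by
      conv_lhs => rw [← sum_smulRight_coordL D]
      refine Finset.sum_congr rfl fun j _ => ?_
      conv_lhs => rw [← sum_apply_coordL (coordL 𝕜 X j ∘L D)]
      ext y
      simp [Finset.sum_smul, mul_smul]
    conv_lhs => rw [h1]
    simp [m, mul_comm]
  refine le_of_forall_pos_le_add fun η hη => ?_
  have hε : 0 < η / (‖R‖ + 1) := by positivity
  obtain ⟨ι, _, ψ, x, hψ, hx, hrep⟩ := exists_repr_functional (φ ∘ₗ bidualComp (B ∘L T)) hφ hε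
  choose z hz hzx using fun i => hB.exists_eq (x i)
  -- Testing the representation on the rank one operators `b ⊗ e_k` identifies the images under `B`;
  -- injectivity of `B` then applies.
  have hT : ∀ k, T (m k) = ∑ i, ψ i (Module.finBasis 𝕜 X k) • z i := by
    intro k
    refine hB.injective ?_
    ext b
    have h1 := hrep (b.smulRight (Module.finBasis 𝕜 X k))
    have h2 : ∀ i, ψ i ∘L b.smulRight (Module.finBasis 𝕜 X k) =
        ψ i (Module.finBasis 𝕜 X k) • b := fun i => by ext; simp [mul_comm]
    rw [LinearMap.comp_apply, hm] at h1
    simp only [bidualComp_smulRight, map_smul, coordL_finBasis, h2] at h1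
    simpa [hz] using h1
  have h3 : φ (R ∘L T) = ∑ i, ψ i (R (z i)) := by
    rw [hm]
    have h4 : ∀ i, ψ i (R (z i)) =
        ∑ j, ψ i (Module.finBasis 𝕜 X j) * coordL 𝕜 X j (R (z i)) := fun i => by
      conv_lhs => rw [← sum_apply_coordL (ψ i)]
      simp
    simp only [ContinuousLinearMap.comp_apply, hT, map_sum, map_smul, h4, smul_eq_mul]
    exact Finset.sum_comm
  rw [h3]
  calc ‖∑ i, ψ i (R (z i))‖ ≤ ∑ i, ‖ψ i (R (z i))‖ := norm_sum_le _ _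
    _ ≤ ∑ i, ‖R‖ * ‖z i‖ := Finset.sum_le_sum fun i _ =>
        ((ψ i).le_of_opNorm_le (hψ i) _).trans (by rw [one_mul]; exact R.le_opNorm _)
    _ = ‖R‖ * ∑ i, ‖z i‖ := by rw [Finset.mul_sum]
    _ ≤ ‖R‖ * ∑ i, ‖x i‖ := by gcongr with i; exact hzx i
    _ ≤ ‖R‖ * (1 + η / (‖R‖ + 1)) := by gcongr
    _ = ‖R‖ + η * (‖R‖ / (‖R‖ + 1)) := by ring
    _ ≤ ‖R‖ + η := by
        gcongr
        refine mul_le_of_le_one_right hη.le ?_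
        rw [div_le_one (by positivity)]
        linarith

/-- An operator version of Helly's lemma: an operator `R : E'' → X` of finite rank is, on a
finite-dimensional space, a limit of biadjoints of operators `W : E → X` of norm at most `‖R‖`. -/
theorem exists_bidualComp_approx [FiniteDimensional 𝕜 M]
    (hB : IsBidual B) (T : M →L[𝕜] Z) (R : Z →L[𝕜] X)
    {η : ℝ} (hη : 0 < η) :
    ∃ W : E →L[𝕜] X, ‖W‖ ≤ ‖R‖ + η ∧ ‖R ∘L T - bidualComp (B ∘L T) W‖ ≤ η := by
  -- The penalty is so large that `K * η = ‖R‖ + 2 * η`; a total cost below `‖R‖ + η` thus forces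
  -- the error below `η`.
  set K : ℝ := (‖R‖ + η + η) / η
  have hK : 0 < K := by positivity
  have hK0 : ENNReal.ofReal K ≠ 0 := by simpa using hK
  -- Taking `D = W'' T` shows that a functional dominated by `q` is at most `‖W‖` there, as
  -- `norm_functional_comp_le` requires.
  let q : (M →L[𝕜] X) → ℝ≥0∞ := fun D =>
    ⨅ W : E →L[𝕜] X, (‖W‖ₑ + ENNReal.ofReal K * ‖D - bidualComp (B ∘L T) W‖ₑ)
  have hle : ∀ D W, q D ≤ ‖W‖ₑ + ENNReal.ofReal K * ‖D - bidualComp (B ∘L T) W‖ₑ := fun D W =>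
    iInf_le _ W
  have hfin : ∀ D, q D ≠ ∞ := fun D => by
    refine ne_top_of_le_ne_top ?_ (hle D 0)
    finiteness
  have hadd : ∀ v w, q (v + w) ≤ q v + q w := fun v w => by
    refine ENNReal.le_iInf_add_iInf fun V W => (hle _ (V + W)).trans ?_
    have h1 : v + w - bidualComp (B ∘L T) (V + W) = (v - bidualComp (B ∘L T) V) + (w - bidualComp (B ∘L T) W) := by
      rw [map_add]; abel
    rw [h1]
    calc _ ≤ ‖V‖ₑ + ‖W‖ₑ + ENNReal.ofReal K *
          (‖v - bidualComp (B ∘L T) V‖ₑ + ‖w - bidualComp (B ∘L T) W‖ₑ) := by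
          gcongr
          · exact enorm_add_le V W
          · exact enorm_add_le (v - bidualComp (B ∘L T) V) (w - bidualComp (B ∘L T) W)
      _ = _ := by ring
  have hsmul : ∀ (c : 𝕜) v, q (c • v) ≤ ‖c‖ₑ * q v := fun c v => by
    rw [ENNReal.mul_iInf (fun h => absurd h enorm_ne_top)]
    refine le_iInf fun W => (hle _ (c • W)).trans_eq ?_
    rw [map_smul, ← smul_sub, enorm_smul, enorm_smul]
    ring
  obtain ⟨φ, hφ, hφR⟩ := exists_dual_enorm_le q hfin hadd hsmul (R ∘L T)
  have h1 : ‖φ (R ∘L T)‖ ≤ ‖R‖ := norm_functional_comp_le hB T φ (fun W => by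
    have := (hφ (bidualComp (B ∘L T) W)).trans (hle _ W)
    rw [← ofReal_norm, ← ofReal_norm, ← ofReal_norm, sub_self, norm_zero, ENNReal.ofReal_zero,
      mul_zero, add_zero] at this
    exact (ENNReal.ofReal_le_ofReal_iff (norm_nonneg _)).1 this) R
  have h2 : q (R ∘L T) < ENNReal.ofReal (‖R‖ + η) := by
    rw [← hφR, ← ofReal_norm]
    exact (ENNReal.ofReal_lt_ofReal_iff (by positivity)).2 (by linarith)
  obtain ⟨W, hW⟩ := iInf_lt_iff.1 h2
  rw [← ofReal_norm, ← ofReal_norm, ← ENNReal.ofReal_mul hK.le,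
    ← ENNReal.ofReal_add (by positivity) (by positivity),
    ENNReal.ofReal_lt_ofReal_iff (by positivity)] at hW
  refine ⟨W, ?_, ?_⟩
  · have : 0 ≤ K * ‖R ∘L T - bidualComp (B ∘L T) W‖ := by positivity
    linarith
  · have h3 : K * ‖R ∘L T - bidualComp (B ∘L T) W‖ ≤ K * η := by
      have : K * η = ‖R‖ + η + η := by simp only [K]; field_simp
      linarith [norm_nonneg W]
    exact le_of_mul_le_mul_left h3 hK

end Bidual

section

variable {𝕜 : Type} [RCLike 𝕜]
variable {D E F G : Type u} [NormedAddCommGroup D] [NormedSpace 𝕜 D] [CompleteSpace D]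
  [NormedAddCommGroup E] [NormedSpace 𝕜 E] [CompleteSpace E]
  [NormedAddCommGroup F] [NormedSpace 𝕜 F] [CompleteSpace F]
  [NormedAddCommGroup G] [NormedSpace 𝕜 G] [CompleteSpace G]
variable {A : OperatorClass.{u} 𝕜}

/-! ### Elementary properties of Banach ideals. -/

section Basic

theorem enorm_le_of_norm_le {V W : Type*} [SeminormedAddCommGroup V] [SeminormedAddCommGroup W]
    {x : V} {y : W} (h : ‖x‖ ≤ ‖y‖) : ‖x‖ₑ ≤ ‖y‖ₑ := by
  rw [← ofReal_norm, ← ofReal_norm]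
  exact ENNReal.ofReal_le_ofReal h

theorem enorm_le_one_of_norm_le {V : Type*} [SeminormedAddCommGroup V] {x : V} (h : ‖x‖ ≤ 1) :
    ‖x‖ₑ ≤ 1 := by
  rw [← ofReal_norm]
  exact ENNReal.ofReal_le_one.2 h

theorem enorm_id_le {V : Type*} [NormedAddCommGroup V] [NormedSpace 𝕜 V] :
    ‖ContinuousLinearMap.id 𝕜 V‖ₑ ≤ 1 :=
  enorm_le_one_of_norm_le ContinuousLinearMap.norm_id_le

theorem enorm_linearIsometry_le {V W : Type*} [NormedAddCommGroup V] [NormedSpace 𝕜 V]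
    [NormedAddCommGroup W] [NormedSpace 𝕜 W] (i : V →ₗᵢ[𝕜] W) :
    ‖i.toContinuousLinearMap‖ₑ ≤ 1 :=
  enorm_le_one_of_norm_le i.norm_toContinuousLinearMap_le

theorem enorm_subtypeL_le {V : Type*} [NormedAddCommGroup V] [NormedSpace 𝕜 V]
    (N : Submodule 𝕜 V) : ‖N.subtypeL‖ₑ ≤ 1 :=
  enorm_le_one_of_norm_le N.norm_subtypeL_le

theorem IsBanachIdeal.gauge_zero (hA : IsBanachIdeal A) : A.gauge (0 : E →L[𝕜] F) = 0 :=
  (hA.gauge_eq_zero _).2 rfl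

theorem IsBanachIdeal.gauge_comp_left (hA : IsBanachIdeal A) (R : F →L[𝕜] G) (T : E →L[𝕜] F) :
    A.gauge (R ∘L T) ≤ ‖R‖ₑ * A.gauge T := by
  refine (hA.gauge_comp_le R T (ContinuousLinearMap.id 𝕜 E)).trans ?_
  exact mul_le_of_le_one_right (zero_le) enorm_id_le

theorem IsBanachIdeal.gauge_comp_right (hA : IsBanachIdeal A) (T : E →L[𝕜] F) (S : D →L[𝕜] E) :
    A.gauge (T ∘L S) ≤ A.gauge T * ‖S‖ₑ := by
  refine (hA.gauge_comp_le (ContinuousLinearMap.id 𝕜 F) T S).trans ?_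
  gcongr
  exact mul_le_of_le_one_left (zero_le) enorm_id_le

theorem IsBanachIdeal.gauge_neg (hA : IsBanachIdeal A) (T : E →L[𝕜] F) :
    A.gauge (-T) = A.gauge T := by
  have := hA.gauge_smul (-1) T
  simpa using this

theorem IsBanachIdeal.gauge_sub_comm (hA : IsBanachIdeal A) (S T : E →L[𝕜] F) :
    A.gauge (S - T) = A.gauge (T - S) := by
  rw [← hA.gauge_neg, neg_sub]

theorem IsBanachIdeal.gauge_sum_le (hA : IsBanachIdeal A) {ι : Type*} (s : Finset ι)
    (T : ι → E →L[𝕜] F) : A.gauge (∑ i ∈ s, T i) ≤ ∑ i ∈ s, A.gauge (T i) := by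
  classical
  induction s using Finset.induction_on with
  | empty => simp [hA.gauge_zero]
  | insert i s hi ih =>
    rw [Finset.sum_insert hi, Finset.sum_insert hi]
    exact (hA.gauge_add_le _ _).trans (by gcongr)

theorem IsBanachIdeal.gauge_id_span (hA : IsBanachIdeal A) {V : Type u} [NormedAddCommGroup V]
    [NormedSpace 𝕜 V] {x : V} (hx : x ≠ 0) :
    A.gauge (ContinuousLinearMap.id 𝕜 (Submodule.span 𝕜 {x})) = 1 :=
  hA.gauge_id _ (finrank_span_singleton hx)

theorem IsBanachIdeal.gauge_smulRight_ne_top (hA : IsBanachIdeal A) (b : StrongDual 𝕜 E) (x : F) :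
    A.gauge (b.smulRight x) ≠ ∞ := by
  rcases eq_or_ne x 0 with rfl | hx
  · have : b.smulRight (0 : F) = 0 := by ext; simp
    simp [this, hA.gauge_zero]
  · let x' : Submodule.span 𝕜 {x} := ⟨x, Submodule.mem_span_singleton_self x⟩
    have h : b.smulRight x = (Submodule.span 𝕜 {x}).subtypeL ∘L
        ContinuousLinearMap.id 𝕜 (Submodule.span 𝕜 {x}) ∘L b.smulRight x' := by
      ext y; simp [x']
    rw [h]
    refine ne_top_of_le_ne_top ?_ (hA.gauge_comp_le _ _ _)
    rw [hA.gauge_id_span hx]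
    finiteness

theorem IsBanachIdeal.gauge_ne_top_of_finiteDimensional_right (hA : IsBanachIdeal A)
    [FiniteDimensional 𝕜 F] (T : E →L[𝕜] F) : A.gauge T ≠ ∞ := by
  rw [← sum_smulRight_coordL T]
  refine ne_top_of_le_ne_top ?_ (hA.gauge_sum_le _ _)
  exact ENNReal.sum_ne_top.2 fun i _ => hA.gauge_smulRight_ne_top _ _

/-- Between the line through `x` and a norming functional of `T x`, the operator `T` becomes `‖T x‖`
times the identity of a line, whose ideal norm is `1`. -/
theorem IsBanachIdeal.enorm_le_gauge (hA : IsBanachIdeal A) (T : E →L[𝕜] F) :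
    ‖T‖ₑ ≤ A.gauge T := by
  refine ContinuousLinearMap.opENorm_le_bound _ fun x => ?_
  rcases eq_or_ne x 0 with rfl | hx
  · simp
  obtain ⟨b, hb, hbx⟩ := exists_dual_vector'' 𝕜 (T x)
  let N := Submodule.span 𝕜 {x}
  let x' : N := ⟨x, Submodule.mem_span_singleton_self x⟩
  have h : (b.smulRight x') ∘L T ∘L N.subtypeL = b (T x) • ContinuousLinearMap.id 𝕜 N := by
    ext ⟨y, hy⟩
    obtain ⟨c, rfl⟩ := Submodule.mem_span_singleton.1 hy
    simp [x', smul_smul, mul_comm]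
  have h1 := hA.gauge_comp_le (b.smulRight x') T N.subtypeL
  rw [h, hA.gauge_smul, hA.gauge_id_span hx, mul_one, hbx] at h1
  have h2 : ‖((‖T x‖ : ℝ) : 𝕜)‖ₑ = ‖T x‖ₑ := by
    rw [← ofReal_norm, ← ofReal_norm]; simp
  have h3 : ‖b.smulRight x'‖ₑ ≤ ‖x‖ₑ := enorm_le_of_norm_le (by
    rw [ContinuousLinearMap.norm_smulRight_apply]
    exact mul_le_of_le_one_left (norm_nonneg _) hb)
  rw [h2] at h1
  calc ‖T x‖ₑ ≤ ‖b.smulRight x'‖ₑ * A.gauge T * ‖N.subtypeL‖ₑ := h1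
    _ ≤ ‖x‖ₑ * A.gauge T * 1 := by gcongr; exact enorm_subtypeL_le N
    _ = A.gauge T * ‖x‖ₑ := by ring

/-- Countable subadditivity of the norm of a Banach ideal. -/
theorem IsBanachIdeal.gauge_le_tsum (hA : IsBanachIdeal A) (T : ℕ → E →L[𝕜] F) {L : E →L[𝕜] F}
    (hL : HasSum T L) : A.gauge L ≤ ∑' n, A.gauge (T n) := by
  rcases eq_or_ne (∑' n, A.gauge (T n)) ∞ with htop | htop
  · simp [htop]
  set S : ℕ → E →L[𝕜] F := fun n => ∑ i ∈ Finset.range n, T i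
  have hS : ∀ n, A.gauge (S n) ≤ ∑' n, A.gauge (T n) := fun n =>
    (hA.gauge_sum_le _ _).trans (ENNReal.sum_le_tsum _)
  have htail : ∀ k m, k ≤ m → A.gauge (S m - S k) ≤ ∑' n, A.gauge (T (n + k)) := by
    intro k m hkm
    have h1 : S m - S k = ∑ i ∈ Finset.range (m - k), T (i + k) := by
      simp only [S]
      rw [← Finset.sum_Ico_eq_sub _ hkm, Finset.sum_Ico_eq_sum_range]
      simp only [add_comm k]
    rw [h1]
    exact (hA.gauge_sum_le _ _).trans (ENNReal.sum_le_tsum _)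
  obtain ⟨L', hL'mem, hL'⟩ := hA.complete S (fun n => ne_top_of_le_ne_top htop (hS n)) (by
    intro ε hε
    have ht := ENNReal.tendsto_sum_nat_add (fun n => A.gauge (T n)) htop
    obtain ⟨k, hk⟩ := (ht.eventually (gt_mem_nhds (ENNReal.half_pos hε.ne'))).exists
    refine ⟨k, fun m hm n hn => ?_⟩
    have h1 : S m - S n = (S m - S k) + (S k - S n) := by abel
    rw [h1]
    refine (hA.gauge_add_le _ _).trans ?_
    rw [hA.gauge_sub_comm (S k)]
    exact (add_le_add ((htail k m hm).trans hk.le) ((htail k n hn).trans hk.le)).trans_eq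
      (ENNReal.add_halves ε))
  -- The limit in the ideal norm is also the limit in the operator norm, hence equals `L`.
  have hSL' : Filter.Tendsto S Filter.atTop (nhds L') := by
    rw [tendsto_iff_edist_tendsto_0]
    refine tendsto_of_tendsto_of_tendsto_of_le_of_le tendsto_const_nhds hL' (fun _ => zero_le)
      fun n => ?_
    rw [edist_eq_enorm_sub]
    exact hA.enorm_le_gauge _
  obtain rfl : L' = L := tendsto_nhds_unique hSL' hL.tendsto_sum_nat
  have hlim : Filter.Tendsto (fun n => ∑' n, A.gauge (T n) + A.gauge (S n - L')) Filter.atTop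
      (nhds (∑' n, A.gauge (T n) + 0)) := tendsto_const_nhds.add hL'
  rw [add_zero] at hlim
  refine ge_of_tendsto' hlim fun n => ?_
  have h1 : L' = S n + (L' - S n) := by abel
  calc A.gauge L' = A.gauge (S n + (L' - S n)) := by rw [← h1]
    _ ≤ A.gauge (S n) + A.gauge (L' - S n) := hA.gauge_add_le _ _
    _ ≤ _ := by rw [hA.gauge_sub_comm L']; gcongr; exact hS n

end Basic

/-! ### Adjoint and conjugate ideals, and finite-dimensional trace duality. -/

section Adjoint

theorem adjoint_gauge_le {T : E →L[𝕜] F} {k : ℝ≥0∞}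
    (h : ∀ (E₀ F₀ : Type u)
        [NormedAddCommGroup E₀] [NormedSpace 𝕜 E₀] [CompleteSpace E₀]
        [NormedAddCommGroup F₀] [NormedSpace 𝕜 F₀] [CompleteSpace F₀]
        (B : E₀ →L[𝕜] E) (S : F₀ →L[𝕜] E₀) (R : F →L[𝕜] F₀),
        IsFiniteOp B → A.Mem S → IsFiniteOp R →
        ‖finTrace (T ∘L B ∘L S ∘L R)‖ₑ ≤ k * ‖B‖ₑ * A.gauge S * ‖R‖ₑ) :
    A.adjoint.gauge T ≤ k := by
  refine le_of_forall_gt_imp_ge_of_dense fun c hc => ?_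
  rcases eq_or_ne c ∞ with rfl | hct
  · exact le_top
  lift c to ℝ≥0 using hct
  refine iInf₂_le c ?_
  intro E₀ F₀ _ _ _ _ _ _ B S R hB hS hR
  exact (h E₀ F₀ B S R hB hS hR).trans (by gcongr)

theorem enorm_finTrace_le {T : E →L[𝕜] F} (hT : A.adjoint.Mem T) {B : D →L[𝕜] E} {S : G →L[𝕜] D}
    {R : F →L[𝕜] G} (hB : IsFiniteOp B) (hS : A.Mem S) (hR : IsFiniteOp R) :
    ‖finTrace (T ∘L B ∘L S ∘L R)‖ₑ ≤ A.adjoint.gauge T * (‖B‖ₑ * A.gauge S * ‖R‖ₑ) := by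
  have key : ∀ c, A.adjoint.gauge T < c →
      ‖finTrace (T ∘L B ∘L S ∘L R)‖ₑ ≤ c * (‖B‖ₑ * A.gauge S * ‖R‖ₑ) := by
    intro c hc
    obtain ⟨c₀, hc₀⟩ := iInf_lt_iff.1 hc
    obtain ⟨h, hlt⟩ := iInf_lt_iff.1 hc₀
    refine (h D G B S R hB hS hR).trans ?_
    rw [mul_assoc, mul_assoc, ← mul_assoc ‖B‖ₑ]
    gcongr
  have hS' : A.gauge S ≠ ∞ := hS
  have hk : ‖B‖ₑ * A.gauge S * ‖R‖ₑ ≠ ∞ := by finiteness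
  -- The infimum is reached by letting `c` decrease, which needs a division; if the product
  -- vanishes, any finite admissible `c` already gives trace zero.
  rcases eq_or_ne (‖B‖ₑ * A.gauge S * ‖R‖ₑ) 0 with h0 | h0
  · obtain ⟨c, hc, _⟩ := exists_between (lt_top_iff_ne_top.2 hT)
    simpa [h0] using key c hc
  · rw [← ENNReal.div_le_iff h0 hk]
    refine le_of_forall_gt_imp_ge_of_dense fun c hc => ?_
    rw [ENNReal.div_le_iff h0 hk]
    exact key c hc

theorem adjoint_gauge_comp_le {T : E →L[𝕜] F} (hT : A.adjoint.Mem T) (Q : F →L[𝕜] G)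
    (J : D →L[𝕜] E) : A.adjoint.gauge (Q ∘L T ∘L J) ≤ ‖Q‖ₑ * A.adjoint.gauge T * ‖J‖ₑ := by
  refine adjoint_gauge_le fun E₀ F₀ _ _ _ _ _ _ B S R hB hS hR => ?_
  have h1 : (Q ∘L T ∘L J) ∘L B ∘L S ∘L R = Q ∘L (T ∘L J ∘L B ∘L S ∘L R) := rfl
  have h2 : (T ∘L J ∘L B ∘L S ∘L R) ∘L Q = T ∘L (J ∘L B) ∘L S ∘L (R ∘L Q) := rfl
  have hU : IsFiniteOp (T ∘L J ∘L B ∘L S ∘L R) :=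
    (((hR.comp_left S).comp_left B).comp_left J).comp_left T
  rw [h1, finTrace_comp_comm hU, h2]
  refine (enorm_finTrace_le hT (hB.comp_left J) hS (hR.comp_right Q)).trans ?_
  calc A.adjoint.gauge T * (‖J ∘L B‖ₑ * A.gauge S * ‖R ∘L Q‖ₑ)
      ≤ A.adjoint.gauge T * (‖J‖ₑ * ‖B‖ₑ * A.gauge S * (‖R‖ₑ * ‖Q‖ₑ)) := by
        gcongr
        · exact ContinuousLinearMap.opENorm_comp_le _ _
        · exact ContinuousLinearMap.opENorm_comp_le _ _
    _ = _ := by ring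

/-- The bound is only asked for `c > k`, which leaves room to choose nearly optimal factorizations
when `k` is an infimum. -/
theorem conjugate_gauge_le {T : E →L[𝕜] F} {k : ℝ≥0∞}
    (h : ∀ c : ℝ≥0, k < c → ∀ L : F →L[𝕜] E, IsFiniteOp L →
      ‖finTrace (T ∘L L)‖ₑ ≤ c * A.gauge L) :
    A.conjugate.gauge T ≤ k := by
  refine le_of_forall_gt_imp_ge_of_dense fun c hc => ?_
  rcases eq_or_ne c ∞ with rfl | hct
  · exact le_top
  lift c to ℝ≥0 using hct
  exact iInf₂_le c (h c hc)

theorem le_conjugate_gauge {T : E →L[𝕜] F} {k : ℝ≥0∞} {L : F →L[𝕜] E} (hL : IsFiniteOp L)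
    {m : ℝ≥0∞} (hm : A.gauge L ≤ m) (h : ∀ c : ℝ≥0∞, ‖finTrace (T ∘L L)‖ₑ ≤ c * m → k ≤ c) :
    k ≤ A.conjugate.gauge T :=
  le_iInf₂ fun c hc => h c ((hc L hL).trans (by gcongr))

theorem finTrace_eq_trace {M : Type u} [NormedAddCommGroup M] [NormedSpace 𝕜 M]
    [FiniteDimensional 𝕜 M] (T : M →L[𝕜] M) :
    finTrace T = LinearMap.trace 𝕜 M T.toLinearMap :=
  finTrace_eq_trace_comp (ContinuousLinearMap.id 𝕜 M) T

/-- Trace duality between finite-dimensional spaces. -/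
theorem IsBanachIdeal.gauge_le_adjoint_adjoint (hA : IsBanachIdeal A) [FiniteDimensional 𝕜 E]
    [FiniteDimensional 𝕜 F] (V : E →L[𝕜] F) : A.gauge V ≤ A.adjoint.adjoint.gauge V := by
  obtain ⟨φ, hφ, hφV⟩ := exists_dual_enorm_le (𝕜 := 𝕜) (fun W : E →L[𝕜] F => A.gauge W)
    (fun W => hA.gauge_ne_top_of_finiteDimensional_right W) (fun _ _ => hA.gauge_add_le _ _)
    (fun c W => (hA.gauge_smul c W).le) V
  -- `U` represents the norming functional by trace duality: `tr (U W) = φ W`. The ideal property of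
  -- `A` makes its `A^*`-norm at most `1`.
  let U₀ : F →ₗ[𝕜] E :=
    { toFun := fun y => ∑ k, φ ((coordL 𝕜 E k).smulRight y) • Module.finBasis 𝕜 E k
      map_add' := fun x y => by
        have : ∀ k, (coordL 𝕜 E k).smulRight (x + y) =
          (coordL 𝕜 E k).smulRight x + (coordL 𝕜 E k).smulRight y := fun k => by ext; simp
        simp [this, add_smul, Finset.sum_add_distrib]
      map_smul' := fun c x => by
        have : ∀ k, (coordL 𝕜 E k).smulRight (c • x) =
          c • (coordL 𝕜 E k).smulRight x := fun k => by ext; simp [smul_smul, mul_comm]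
        simp [this, mul_smul, Finset.smul_sum] }
  let U : F →L[𝕜] E := LinearMap.toContinuousLinearMap U₀
  have hU : ∀ y k, coordL 𝕜 E k (U y) = φ ((coordL 𝕜 E k).smulRight y) := fun y k => by
    change coordL 𝕜 E k (∑ j, φ ((coordL 𝕜 E j).smulRight y) • Module.finBasis 𝕜 E j) = _
    simp [coordL_finBasis]
  have htr : ∀ W : E →L[𝕜] F, finTrace (U ∘L W) = φ W := fun W => by
    have h1 : W = ∑ k, (coordL 𝕜 E k).smulRight (W (Module.finBasis 𝕜 E k)) := by
      ext x
      conv_lhs => rw [← sum_coordL_smul (𝕜 := 𝕜) x]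
      simp
    rw [finTrace_eq_trace, trace_eq_sum_coordL]
    conv_rhs => rw [h1, map_sum]
    exact Finset.sum_congr rfl fun k _ => hU _ k
  have hU1 : A.adjoint.gauge U ≤ 1 := by
    refine adjoint_gauge_le fun E₀ F₀ _ _ _ _ _ _ B S R hB hS hR => ?_
    rw [htr, one_mul]
    exact (hφ _).trans (hA.gauge_comp_le B S R)
  refine le_iInf₂ fun c hc => ?_
  -- `U` between two identities is an admissible test operator for `A^{**}(V)`.
  have h3 := hc E F (ContinuousLinearMap.id 𝕜 E) U (ContinuousLinearMap.id 𝕜 F)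
    (IsFiniteOp.of_finiteDimensional_left _) (ne_top_of_le_ne_top ENNReal.one_ne_top hU1)
    (IsFiniteOp.of_finiteDimensional_left _)
  have h4 : V ∘L ContinuousLinearMap.id 𝕜 E ∘L U ∘L ContinuousLinearMap.id 𝕜 F = V ∘L U := rfl
  rw [h4, finTrace_comp_comm (IsFiniteOp.of_finiteDimensional_left U), htr, hφV] at h3
  calc A.gauge V ≤ _ := h3
    _ ≤ c * 1 * 1 * 1 := by
        gcongr
        · exact enorm_id_le
        · exact enorm_id_le
    _ = c := by simp

end Adjoint

end

/-! ### The cost of factoring through finite-dimensional spaces. -/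

section FactorGauge

variable {𝕜 : Type} [RCLike 𝕜] {A : OperatorClass.{u} 𝕜}
variable {E M : Type u} [NormedAddCommGroup E] [NormedSpace 𝕜 E]
  [NormedAddCommGroup M] [NormedSpace 𝕜 M] [CompleteSpace M]

/-- The infimum of `A(V)` over all factorizations `W = V R` through a finite-dimensional space with
`‖R‖ ≤ 1`. -/
def factorGauge (A : OperatorClass.{u} 𝕜) (W : E →L[𝕜] M) : ℝ≥0∞ :=
  sInf {r : ℝ≥0∞ | ∃ (G : Type u) (_ : NormedAddCommGroup G) (_ : NormedSpace 𝕜 G)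
    (_ : CompleteSpace G) (_ : FiniteDimensional 𝕜 G) (R : E →L[𝕜] G) (V : G →L[𝕜] M),
    ‖R‖ ≤ 1 ∧ W = V ∘L R ∧ r = A.gauge V}

theorem factorGauge_le {G : Type u} [NormedAddCommGroup G] [NormedSpace 𝕜 G] [CompleteSpace G]
    [FiniteDimensional 𝕜 G] {R : E →L[𝕜] G} (hR : ‖R‖ ≤ 1) (V : G →L[𝕜] M) :
    factorGauge A (V ∘L R) ≤ A.gauge V :=
  sInf_le ⟨G, _, _, _, inferInstance, R, V, hR, rfl, rfl⟩

theorem factorGauge_zero (hA : IsBanachIdeal A) [FiniteDimensional 𝕜 M] :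
    factorGauge A (0 : E →L[𝕜] M) = 0 := by
  have h := factorGauge_le (A := A) (R := (0 : E →L[𝕜] M)) (by simp) (0 : M →L[𝕜] M)
  rw [hA.gauge_zero, ContinuousLinearMap.comp_zero] at h
  exact le_antisymm h zero_le

theorem factorGauge_comp_le (hA : IsBanachIdeal A) [FiniteDimensional 𝕜 M] {G : Type u}
    [NormedAddCommGroup G] [NormedSpace 𝕜 G] [CompleteSpace G] [FiniteDimensional 𝕜 G]
    (R : E →L[𝕜] G) (V : G →L[𝕜] M) : factorGauge A (V ∘L R) ≤ A.gauge V * ‖R‖ₑ := by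
  rcases eq_or_ne R 0 with rfl | hR
  · rw [ContinuousLinearMap.comp_zero, factorGauge_zero hA]
    exact zero_le
  have hn : (‖R‖ : 𝕜) ≠ 0 := by simpa using hR
  have h1 : V ∘L R = ((‖R‖ : 𝕜) • V) ∘L ((‖R‖ : 𝕜)⁻¹ • R) := by
    ext x
    simp [smul_smul, hn]
  have h2 : ‖(‖R‖ : 𝕜)⁻¹ • R‖ ≤ 1 := by
    rw [norm_smul, norm_inv, RCLike.norm_ofReal, abs_norm, inv_mul_cancel₀ (norm_ne_zero_iff.2 hR)]
  rw [h1]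
  refine (factorGauge_le h2 _).trans_eq ?_
  rw [hA.gauge_smul, mul_comm]
  congr 1
  rw [← ofReal_norm, ← ofReal_norm, RCLike.norm_ofReal, abs_norm]

theorem factorGauge_ne_top (hA : IsBanachIdeal A) [FiniteDimensional 𝕜 M] (W : E →L[𝕜] M) :
    factorGauge A W ≠ ∞ := by
  have h := factorGauge_comp_le hA W (ContinuousLinearMap.id 𝕜 M)
  rw [ContinuousLinearMap.id_comp] at h
  exact ne_top_of_le_ne_top
    (ENNReal.mul_ne_top (hA.gauge_ne_top_of_finiteDimensional_right _) enorm_ne_top) h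

/-- The two factorizations are put side by side in the sup-norm product, where the pair `(R₁, R₂)`
still has norm at most `1`. -/
theorem factorGauge_add_le (hA : IsBanachIdeal A) (W₁ W₂ : E →L[𝕜] M) :
    factorGauge A (W₁ + W₂) ≤ factorGauge A W₁ + factorGauge A W₂ := by
  rw [factorGauge, factorGauge, factorGauge, sInf_eq_iInf' {r : ℝ≥0∞ | ∃ (G : Type u)
    (_ : NormedAddCommGroup G) (_ : NormedSpace 𝕜 G)
    (_ : CompleteSpace G) (_ : FiniteDimensional 𝕜 G) (R : E →L[𝕜] G) (V : G →L[𝕜] M),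
    ‖R‖ ≤ 1 ∧ W₁ = V ∘L R ∧ r = A.gauge V}, sInf_eq_iInf' {r : ℝ≥0∞ | ∃ (G : Type u)
    (_ : NormedAddCommGroup G) (_ : NormedSpace 𝕜 G)
    (_ : CompleteSpace G) (_ : FiniteDimensional 𝕜 G) (R : E →L[𝕜] G) (V : G →L[𝕜] M),
    ‖R‖ ≤ 1 ∧ W₂ = V ∘L R ∧ r = A.gauge V}]
  refine ENNReal.le_iInf_add_iInf ?_
  rintro ⟨_, G₁, _, _, _, _, R₁, V₁, hR₁, rfl, rfl⟩ ⟨_, G₂, _, _, _, _, R₂, V₂, hR₂, rfl, rfl⟩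
  have h1 : V₁ ∘L R₁ + V₂ ∘L R₂ =
      (V₁ ∘L ContinuousLinearMap.fst 𝕜 G₁ G₂ + V₂ ∘L ContinuousLinearMap.snd 𝕜 G₁ G₂) ∘L
        R₁.prod R₂ := by
    ext x; simp
  have h2 : ‖R₁.prod R₂‖ ≤ 1 := by
    refine ContinuousLinearMap.opNorm_le_bound _ zero_le_one fun x => ?_
    exact max_le (R₁.le_of_opNorm_le hR₁ x) (R₂.le_of_opNorm_le hR₂ x)
  change factorGauge A (V₁ ∘L R₁ + V₂ ∘L R₂) ≤ _
  rw [h1]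
  refine (factorGauge_le h2 _).trans ((hA.gauge_add_le _ _).trans (add_le_add ?_ ?_))
  · exact (hA.gauge_comp_right _ _).trans (mul_le_of_le_one_right zero_le
      (enorm_le_one_of_norm_le (ContinuousLinearMap.norm_fst_le 𝕜 G₁ G₂)))
  · exact (hA.gauge_comp_right _ _).trans (mul_le_of_le_one_right zero_le
      (enorm_le_one_of_norm_le (ContinuousLinearMap.norm_snd_le 𝕜 G₁ G₂)))

theorem factorGauge_smul_le (hA : IsBanachIdeal A) (c : 𝕜) (W : E →L[𝕜] M) [FiniteDimensional 𝕜 M] :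
    factorGauge A (c • W) ≤ ‖c‖ₑ * factorGauge A W := by
  rcases eq_or_ne c 0 with rfl | hc
  · rw [zero_smul, factorGauge_zero hA]
    exact zero_le
  rw [mul_comm, ← ENNReal.div_le_iff (by simpa using hc) enorm_ne_top]
  refine le_sInf ?_
  rintro _ ⟨G, _, _, _, _, R, V, hR, rfl, rfl⟩
  rw [ENNReal.div_le_iff (by simpa using hc) enorm_ne_top, mul_comm, ← hA.gauge_smul]
  exact factorGauge_le hR (c • V)

/-- A functional dominated by `factorGauge A` induces an operator `M → E''` of `A^{***}`-norm at
most `1`. -/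
theorem adjoint_adjoint_adjoint_gauge_le_one (hA : IsBanachIdeal A) [FiniteDimensional 𝕜 M]
    {Z : Type u} [NormedAddCommGroup Z] [NormedSpace 𝕜 Z] [CompleteSpace Z]
    {B : Z →L[𝕜] StrongDual 𝕜 (StrongDual 𝕜 E)} (hB : IsBidual B) (T : M →L[𝕜] Z)
    (φ : (E →L[𝕜] M) →ₗ[𝕜] 𝕜) (hφ : ∀ W, ‖φ W‖ₑ ≤ factorGauge A W)
    (hT : ∀ m b, B (T m) b = φ (b.smulRight m)) :
    A.adjoint.adjoint.adjoint.gauge T ≤ 1 := by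
  refine adjoint_gauge_le fun E₀ F₀ _ _ _ _ _ _ C S R hC hS hR => ?_
  have : FiniteDimensional 𝕜 (LinearMap.range R.toLinearMap) := hR
  have : CompleteSpace (LinearMap.range R.toLinearMap) := FiniteDimensional.complete 𝕜 _
  set X := LinearMap.range R.toLinearMap
  set R₁ : Z →L[𝕜] X := rangeRestrictL R
  -- Restricting to the range of `R` makes `V` an operator between finite-dimensional spaces, where
  -- `A ≤ A^{**}`.
  set V : X →L[𝕜] M := C ∘L S ∘L X.subtypeL
  have hV : A.gauge V ≤ ‖C‖ₑ * A.adjoint.adjoint.gauge S :=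
    (hA.gauge_le_adjoint_adjoint V).trans ((adjoint_gauge_comp_le hS C X.subtypeL).trans
      (mul_le_of_le_one_right zero_le (enorm_subtypeL_le X)))
  have hSt : A.adjoint.adjoint.gauge S ≠ ∞ := hS
  set a : ℝ≥0∞ := ‖C‖ₑ * A.adjoint.adjoint.gauge S
  have ha : a ≠ ∞ := by finiteness
  have e1 : T ∘L C ∘L S ∘L R = T ∘L (V ∘L R₁) := rfl
  let τ₀ : (M →L[𝕜] X) →ₗ[𝕜] 𝕜 :=
    { toFun := fun D => LinearMap.trace 𝕜 M (V ∘L D).toLinearMap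
      map_add' := fun D₁ D₂ => by
        rw [ContinuousLinearMap.comp_add, ContinuousLinearMap.toLinearMap_add, map_add]
      map_smul' := fun c D => by
        rw [ContinuousLinearMap.comp_smul, ContinuousLinearMap.toLinearMap_smul, map_smul]
        rfl }
  let τ : StrongDual 𝕜 (M →L[𝕜] X) := LinearMap.toContinuousLinearMap τ₀
  have e2 : finTrace (T ∘L C ∘L S ∘L R) = τ (R₁ ∘L T) := by
    rw [e1, finTrace_eq_trace_comp]
    rfl
  have hτ : ∀ W : E →L[𝕜] X, ‖τ (bidualComp (B ∘L T) W)‖ ≤ a.toReal * ‖W‖ := by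
    intro W
    have h1 : τ (bidualComp (B ∘L T) W) = φ (V ∘L W) := by
      rw [eq_trace_bidualComp (B ∘L T) φ hT, bidualComp_comp]
      rfl
    have h2 := (hφ (V ∘L W)).trans (factorGauge_comp_le hA W V)
    rw [h1]
    have h3 : ‖φ (V ∘L W)‖ₑ ≤ a * ‖W‖ₑ := h2.trans (by gcongr)
    rw [← ENNReal.ofReal_toReal ha, ← ofReal_norm, ← ofReal_norm,
      ← ENNReal.ofReal_mul ENNReal.toReal_nonneg] at h3
    exact (ENNReal.ofReal_le_ofReal_iff (by positivity)).1 h3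
  -- Helly's lemma replaces `R₁ T` by `W'' T` with `‖W‖` close to `‖R‖`, and there `τ` equals `φ (V
  -- W)`. The error is absorbed by the continuity of `τ`.
  have key : ‖τ (R₁ ∘L T)‖ ≤ a.toReal * ‖R‖ := by
    refine le_of_forall_pos_le_add fun δ hδ => ?_
    have hK : 0 < a.toReal + ‖τ‖ + 1 := by positivity
    have hη : 0 < δ / (a.toReal + ‖τ‖ + 1) := by positivity
    obtain ⟨W, hW, hWη⟩ := exists_bidualComp_approx hB T R₁ hη
    set η := δ / (a.toReal + ‖τ‖ + 1)
    have h1 : τ (R₁ ∘L T) = τ (bidualComp (B ∘L T) W) +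
        τ (R₁ ∘L T - bidualComp (B ∘L T) W) := by
      rw [map_sub]; abel
    have hR₁ : ‖R₁‖ ≤ ‖R‖ := norm_rangeRestrictL_le R
    rw [h1]
    calc _ ≤ a.toReal * ‖W‖ + ‖τ‖ * η :=
          (norm_add_le _ _).trans (add_le_add (hτ W) (τ.le_opNorm_of_le hWη))
      _ ≤ a.toReal * (‖R‖ + η) + ‖τ‖ * η := by gcongr; linarith
      _ = a.toReal * ‖R‖ + (a.toReal + ‖τ‖) * η := by ring
      _ ≤ a.toReal * ‖R‖ + (a.toReal + ‖τ‖ + 1) * η := by linarith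
      _ = a.toReal * ‖R‖ + δ := by simp only [η]; field_simp
  rw [e2, one_mul]
  have h := ENNReal.ofReal_le_ofReal key
  rwa [ENNReal.ofReal_mul ENNReal.toReal_nonneg, ENNReal.ofReal_toReal ha, ofReal_norm,
    ofReal_norm] at h

end FactorGauge

/-! ### Local reflexivity and factorization through quotients. -/

section Key

variable {𝕜 : Type} [RCLike 𝕜] {A : OperatorClass.{u} 𝕜}
variable {E : Type u} [NormedAddCommGroup E] [NormedSpace 𝕜 E]

theorem isBidual_id : IsBidual (𝕜 := 𝕜) (E := E)
    (Z := StrongDual 𝕜 (StrongDual 𝕜 E)) (ContinuousLinearMap.id 𝕜 _) :=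
  ⟨Function.injective_id, fun x => ⟨x, rfl, le_rfl⟩⟩

theorem norm_liftQL_ker_le {G : Type*} [NormedAddCommGroup G] [NormedSpace 𝕜 G] (R : E →L[𝕜] G)
    (K : Submodule 𝕜 E) [IsClosed (K : Set E)] (hK : K ≤ R.ker) :
    ‖K.liftQL R hK‖ ≤ ‖R‖ := by
  refine ContinuousLinearMap.opNorm_le_bound _ (norm_nonneg _) fun q => ?_
  refine le_of_forall_pos_le_add fun δ hδ => ?_
  obtain ⟨x, rfl, hx⟩ := Submodule.Quotient.norm_mk_lt q (show 0 < δ / (‖R‖ + 1) by positivity)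
  have h1 : K.liftQL R hK (Submodule.Quotient.mk x) = R x := rfl
  rw [h1]
  calc ‖R x‖ ≤ ‖R‖ * ‖x‖ := R.le_opNorm x
    _ ≤ ‖R‖ * (‖(Submodule.Quotient.mk x : E ⧸ K)‖ + δ / (‖R‖ + 1)) := by gcongr
    _ = ‖R‖ * ‖(Submodule.Quotient.mk x : E ⧸ K)‖ + δ * (‖R‖ / (‖R‖ + 1)) := by ring
    _ ≤ _ := by
      gcongr
      refine mul_le_of_le_one_right hδ.le ?_
      rw [div_le_one (by positivity)]
      linarith

/-- Two factors `1 + ε` are provided: one pays for the finite operator `P` on `Y`, the other for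
local reflexivity. -/
theorem exists_pos_mul_lt {a c : ℝ≥0∞} (h : a < c) :
    ∃ ε : ℝ, 0 < ε ∧ a * (ENNReal.ofReal (1 + ε) * ENNReal.ofReal (1 + ε)) < c := by
  have ha : a ≠ ∞ := h.ne_top
  have hc : Filter.Tendsto (fun ε : ℝ => a * ENNReal.ofReal ((1 + ε) * (1 + ε)))
      (nhdsWithin 0 (Set.Ioi 0)) (nhds (a * ENNReal.ofReal ((1 + 0) * (1 + 0)))) := by
    refine ENNReal.Tendsto.const_mul ?_ (Or.inr ha)
    refine (ENNReal.continuous_ofReal.comp (by fun_prop : Continuous fun ε : ℝ =>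
      (1 + ε) * (1 + ε))).tendsto 0 |>.mono_left nhdsWithin_le_nhds
  have h1 : a * ENNReal.ofReal ((1 + 0) * (1 + 0)) < c := by simpa using h
  obtain ⟨ε, hε, hpos⟩ := ((hc.eventually (gt_mem_nhds h1)).and self_mem_nhdsWithin).exists
  have hpos' : 0 < ε := hpos
  exact ⟨ε, hpos', by rwa [← ENNReal.ofReal_mul (by positivity)]⟩

variable [CompleteSpace E] {Y : Type u} [NormedAddCommGroup Y] [NormedSpace 𝕜 Y] [CompleteSpace Y]

/-- The value of `factorGauge A` is controlled by the conjugate of the adjoint. -/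
theorem factorGauge_le_conjugate (hA : IsBanachIdeal A) (hLRP : LocalReflexivity A.adjoint)
    {M : Type u} [NormedAddCommGroup M] [NormedSpace 𝕜 M] [CompleteSpace M]
    [FiniteDimensional 𝕜 M] (ι : M →L[𝕜] Y) (P : Y →L[𝕜] M) (W : E →L[𝕜] M)
    (hP : P ∘L ι ∘L W = W) {ε : ℝ} (hε : 0 < ε) (hPε : ‖P‖ₑ ≤ ENNReal.ofReal (1 + ε)) :
    factorGauge A W ≤ A.adjoint.conjugate.gauge (ι ∘L W) *
      (ENNReal.ofReal (1 + ε) * ENNReal.ofReal (1 + ε)) := by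
  obtain ⟨φ, hφ, hφW⟩ := exists_dual_enorm_le (𝕜 := 𝕜) (fun W : E →L[𝕜] M => factorGauge A W)
    (factorGauge_ne_top hA) (factorGauge_add_le hA) (fun c V => factorGauge_smul_le hA c V) W
  let C : ℝ := (A.gauge (ContinuousLinearMap.id 𝕜 M)).toReal
  have hbound : ∀ (m : M) (b : StrongDual 𝕜 E), ‖φ (b.smulRight m)‖ ≤ C * ‖m‖ * ‖b‖ := by
    intro m b
    have h1 := (hφ (b.smulRight m)).trans
      (factorGauge_comp_le hA (b.smulRight m) (ContinuousLinearMap.id 𝕜 M))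
    rw [← ENNReal.ofReal_toReal
      (hA.gauge_ne_top_of_finiteDimensional_right (ContinuousLinearMap.id 𝕜 M)), ← ofReal_norm,
      ← ofReal_norm, ← ENNReal.ofReal_mul ENNReal.toReal_nonneg,
      ContinuousLinearMap.norm_smulRight_apply] at h1
    have h2 := (ENNReal.ofReal_le_ofReal_iff (by positivity)).1 h1
    calc _ ≤ _ := h2
      _ = _ := by simp only [C]; ring
  let T : M →L[𝕜] StrongDual 𝕜 (StrongDual 𝕜 E) :=
    LinearMap.mkContinuous₂ (LinearMap.mk₂ 𝕜 (fun m (b : StrongDual 𝕜 E) => φ (b.smulRight m))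
      (fun m₁ m₂ b => by rw [← map_add]; congr 1; ext; simp)
      (fun c m b => by rw [smul_eq_mul, ← smul_eq_mul, ← map_smul]; congr 1; ext; simp [smul_smul, mul_comm])
      (fun m b₁ b₂ => by rw [← map_add]; congr 1; ext; simp [add_smul])
      (fun c m b => by rw [← map_smul]; congr 1; ext; simp [mul_smul])) C hbound
  have hT : ∀ m b, T m b = φ (b.smulRight m) := fun m b => rfl
  have hT1 : A.adjoint.adjoint.adjoint.gauge (E := M) (F := StrongDual 𝕜 (StrongDual 𝕜 E)) T ≤ 1 :=
    adjoint_adjoint_adjoint_gauge_le_one hA isBidual_id T φ hφ hT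
  -- The trace of `W S` only involves the functionals `coordL i ∘ W`, so agreement of `S` with `T`
  -- on their span gives `tr (W S) = φ W`.
  let N : Submodule 𝕜 (StrongDual 𝕜 E) := Submodule.span 𝕜 (Set.range fun i => coordL 𝕜 M i ∘L W)
  have : FiniteDimensional 𝕜 N := FiniteDimensional.span_of_finite 𝕜 (Set.finite_range _)
  obtain ⟨S, hS, hSN, -⟩ := hLRP M E T N ε hε
  have hS1 : A.adjoint.gauge S ≤ ENNReal.ofReal (1 + ε) :=
    hS.trans (mul_le_of_le_one_right zero_le hT1)
  have hSmem : A.adjoint.Mem S := ne_top_of_le_ne_top ENNReal.ofReal_ne_top hS1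
  have hSP : A.adjoint.gauge (S ∘L P) ≤ ENNReal.ofReal (1 + ε) * ENNReal.ofReal (1 + ε) := by
    have := adjoint_gauge_comp_le hSmem (ContinuousLinearMap.id 𝕜 E) P
    rw [ContinuousLinearMap.id_comp] at this
    refine this.trans ?_
    gcongr
    exact (mul_le_of_le_one_left zero_le enorm_id_le).trans hS1
  have htr : finTrace ((ι ∘L W) ∘L (S ∘L P)) = φ W := by
    have e1 : (ι ∘L W) ∘L (S ∘L P) = (ι ∘L W ∘L S) ∘L P := rfl
    have e2 : P.toLinearMap ∘ₗ (ι ∘L W ∘L S).toLinearMap = (W ∘L S).toLinearMap := by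
      conv_rhs => rw [← hP]
      rfl
    rw [e1, finTrace_eq_trace_comp, e2, eq_trace_bidualComp T φ hT, trace_eq_sum_coordL,
      trace_eq_sum_coordL]
    refine Finset.sum_congr rfl fun i _ => ?_
    rw [ContinuousLinearMap.coe_coe, ContinuousLinearMap.coe_coe, dual_bidualComp]
    exact hSN _ _ (Submodule.subset_span ⟨i, rfl⟩)
  have hm0 : ENNReal.ofReal (1 + ε) * ENNReal.ofReal (1 + ε) ≠ 0 := by
    have : ENNReal.ofReal (1 + ε) ≠ 0 := by
      rw [ne_eq, ENNReal.ofReal_eq_zero]; linarith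
    exact mul_ne_zero this this
  have hmt : ENNReal.ofReal (1 + ε) * ENNReal.ofReal (1 + ε) ≠ ∞ := by finiteness
  rw [← ENNReal.div_le_iff hm0 hmt]
  refine le_conjugate_gauge (L := S ∘L P) (IsFiniteOp.of_factor P S) hSP fun c hc => ?_
  rw [htr, hφW] at hc
  exact ENNReal.div_le_of_le_mul hc

/-- If `Y` has a strong form of the metric approximation property, then a finite operator
`L : E → Y` factors through a finite-dimensional quotient with `A`-norm close to its
`A^{*Δ}`-norm. -/
theorem exists_quotient_factorization (hA : IsBanachIdeal A) (hLRP : LocalReflexivity A.adjoint)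
    (hY : ∀ (X : Submodule 𝕜 Y) [FiniteDimensional 𝕜 X] (ε : ℝ), 0 < ε →
      ∃ P : Y →L[𝕜] Y, IsFiniteOp P ∧ ‖P‖ ≤ 1 + ε ∧ ∀ x ∈ X, P x = x)
    {L : E →L[𝕜] Y} (hL : IsFiniteOp L) {c : ℝ≥0∞} (hc : A.adjoint.conjugate.gauge L < c) :
    ∃ (K : Submodule 𝕜 E) (_ : IsClosed (K : Set E)) (_ : FiniteDimensional 𝕜 (E ⧸ K))
      (S : (E ⧸ K) →L[𝕜] Y), L = S ∘L K.mkQL ∧ A.gauge S ≤ c := by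
  obtain ⟨ε, hε, hεc⟩ := exists_pos_mul_lt hc
  have : FiniteDimensional 𝕜 (LinearMap.range L.toLinearMap) := hL
  obtain ⟨P, hP, hPn, hPL⟩ := hY (LinearMap.range L.toLinearMap) ε hε
  have : FiniteDimensional 𝕜 (LinearMap.range P.toLinearMap) := hP
  have : CompleteSpace (LinearMap.range P.toLinearMap) := FiniteDimensional.complete 𝕜 _
  set M := LinearMap.range P.toLinearMap
  have hPL' : ∀ x, P (L x) = L x := fun x => hPL _ ⟨x, rfl⟩
  let W : E →L[𝕜] M := rangeRestrictL P ∘L L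
  have hW : M.subtypeL ∘L W = L := by
    ext x; exact hPL' x
  have hPW : rangeRestrictL P ∘L M.subtypeL ∘L W = W := by
    rw [hW]
  have hle := factorGauge_le_conjugate hA hLRP M.subtypeL (rangeRestrictL P) W hPW hε (by
    rw [← ofReal_norm]
    exact ENNReal.ofReal_le_ofReal ((norm_rangeRestrictL_le P).trans hPn))
  rw [hW] at hle
  obtain ⟨_, ⟨G, _, _, _, _, R, V, hR, hWV, rfl⟩, hlt⟩ := sInf_lt_iff.1 (hle.trans_lt hεc)
  -- The factor `R` descends to the quotient by its kernel, which is finite-dimensional since `G`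
  -- is, without increasing its norm.
  have hcl : IsClosed (R.ker : Set E) := R.isClosed_ker
  have hfin : FiniteDimensional 𝕜 (E ⧸ R.ker) :=
    R.toLinearMap.quotKerEquivRange.symm.finiteDimensional
  refine ⟨R.ker, hcl, hfin, M.subtypeL ∘L V ∘L R.ker.liftQL R le_rfl, ?_, ?_⟩
  · rw [← hW, hWV]
    rfl
  · refine (hA.gauge_comp_le _ _ _).trans (le_trans ?_ hlt.le)
    calc _ ≤ 1 * A.gauge V * 1 := by
          gcongr
          · exact enorm_subtypeL_le M
          · exact enorm_le_one_of_norm_le ((norm_liftQL_ker_le R _ le_rfl).trans hR)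
      _ = A.gauge V := by ring

end Key

section

variable {𝕜 : Type} [RCLike 𝕜]
variable {D E F G : Type u} [NormedAddCommGroup D] [NormedSpace 𝕜 D] [CompleteSpace D]
  [NormedAddCommGroup E] [NormedSpace 𝕜 E] [CompleteSpace E]
  [NormedAddCommGroup F] [NormedSpace 𝕜 F] [CompleteSpace F]
  [NormedAddCommGroup G] [NormedSpace 𝕜 G] [CompleteSpace G]
variable {A B : OperatorClass.{u} 𝕜}

/-! ### Products of operator classes and the minimal kernel. -/

section Products

theorem approximable_gauge_of_mem {T : E →L[𝕜] F}
    (hT : T ∈ closure {S : E →L[𝕜] F | IsFiniteOp S}) : approximable.gauge T = ‖T‖ₑ :=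
  if_pos hT

theorem approximable_mem_iff {T : E →L[𝕜] F} :
    approximable.Mem T ↔ T ∈ closure {S : E →L[𝕜] F | IsFiniteOp S} := by
  refine ⟨fun h => ?_, fun h => ?_⟩
  · by_contra hT
    exact h (if_neg hT)
  · rw [OperatorClass.Mem, approximable_gauge_of_mem h]
    exact enorm_ne_top

theorem IsFiniteOp.mem_closure {V W : Type u} [NormedAddCommGroup V] [NormedSpace 𝕜 V]
    [NormedAddCommGroup W] [NormedSpace 𝕜 W] {T : V →L[𝕜] W} (hT : IsFiniteOp T) :
    T ∈ closure {S : V →L[𝕜] W | IsFiniteOp S} :=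
  subset_closure hT

theorem comp_gauge_le {R : E →L[𝕜] G} {S : G →L[𝕜] F} (hR : B.Mem R) (hS : A.Mem S) :
    (A.comp B).gauge (S ∘L R) ≤ A.gauge S * B.gauge R :=
  sInf_le ⟨G, _, _, _, R, S, hR, hS, rfl, rfl⟩

theorem exists_factorization_of_comp_lt {T : E →L[𝕜] F} {c : ℝ≥0∞} (h : (A.comp B).gauge T < c) :
    ∃ (G : Type u) (_ : NormedAddCommGroup G) (_ : NormedSpace 𝕜 G) (_ : CompleteSpace G)
      (R : E →L[𝕜] G) (S : G →L[𝕜] F), B.Mem R ∧ A.Mem S ∧ T = S ∘L R ∧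
        A.gauge S * B.gauge R < c := by
  obtain ⟨_, ⟨G, _, _, _, R, S, hR, hS, hT, rfl⟩, hlt⟩ := sInf_lt_iff.1 h
  exact ⟨G, _, _, _, R, S, hR, hS, hT, hlt⟩

theorem min_gauge_le {W : E →L[𝕜] D} {V : D →L[𝕜] G} {U : G →L[𝕜] F}
    (hW : W ∈ closure {S : E →L[𝕜] D | IsFiniteOp S}) (hV : A.Mem V)
    (hU : U ∈ closure {S : G →L[𝕜] F | IsFiniteOp S}) :
    A.min.gauge (U ∘L V ∘L W) ≤ ‖U‖ₑ * A.gauge V * ‖W‖ₑ := by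
  have h1 : (approximable.comp A).gauge (U ∘L V) ≤ ‖U‖ₑ * A.gauge V := by
    rw [← approximable_gauge_of_mem hU]
    exact comp_gauge_le hV (approximable_mem_iff.2 hU)
  have hV' : A.gauge V ≠ ∞ := hV
  have h2 : (approximable.comp A).Mem (U ∘L V) := ne_top_of_le_ne_top (by finiteness) h1
  calc A.min.gauge ((U ∘L V) ∘L W) ≤ (approximable.comp A).gauge (U ∘L V) * approximable.gauge W :=
        comp_gauge_le (approximable_mem_iff.2 hW) h2
    _ ≤ _ := by rw [approximable_gauge_of_mem hW]; gcongr

theorem exists_factorization_of_min_lt {T : E →L[𝕜] F} {c : ℝ≥0∞} (h : A.min.gauge T < c) :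
    ∃ (G : Type u) (_ : NormedAddCommGroup G) (_ : NormedSpace 𝕜 G) (_ : CompleteSpace G)
      (H : Type u) (_ : NormedAddCommGroup H) (_ : NormedSpace 𝕜 H) (_ : CompleteSpace H)
      (W : E →L[𝕜] G) (V : G →L[𝕜] H) (U : H →L[𝕜] F),
      W ∈ closure {S : E →L[𝕜] G | IsFiniteOp S} ∧ A.Mem V ∧
      U ∈ closure {S : H →L[𝕜] F | IsFiniteOp S} ∧ T = U ∘L V ∘L W ∧
        ‖U‖ₑ * A.gauge V * ‖W‖ₑ < c := by
  obtain ⟨G, _, _, _, W, S, hW, hS, rfl, hlt⟩ := exists_factorization_of_comp_lt h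
  have hW' := approximable_mem_iff.1 hW
  rw [approximable_gauge_of_mem hW'] at hlt
  -- The norm of `S` is itself an infimum, so a margin `d` is reserved for factoring `S`; `‖W‖ₑ = 0`
  -- is separate to avoid dividing by zero.
  obtain ⟨d, hSd, hd⟩ : ∃ d, (approximable.comp A).gauge S < d ∧ d * ‖W‖ₑ < c := by
    rcases eq_or_ne ‖W‖ₑ 0 with h0 | h0
    · obtain ⟨d, hd, -⟩ := exists_between (lt_top_iff_ne_top.2 hS)
      refine ⟨d, hd, ?_⟩
      rwa [h0, mul_zero] at hlt ⊢
    · rw [← ENNReal.lt_div_iff_mul_lt (Or.inl h0) (Or.inl enorm_ne_top)] at hlt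
      obtain ⟨d, hd, hd'⟩ := exists_between hlt
      exact ⟨d, hd, (ENNReal.lt_div_iff_mul_lt (Or.inl h0) (Or.inl enorm_ne_top)).1 hd'⟩
  obtain ⟨H, _, _, _, V, U, hV, hU, rfl, hVU⟩ := exists_factorization_of_comp_lt hSd
  have hU' := approximable_mem_iff.1 hU
  rw [approximable_gauge_of_mem hU'] at hVU
  refine ⟨G, _, _, _, H, _, _, _, W, V, U, hW', hV, hU', rfl, lt_of_le_of_lt ?_ hd⟩
  gcongr

end Products

/-! ### The injective hull and the inequalities that do not use local reflexivity. -/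

section Injective

theorem linftyDualBall_fixing {F : Type u} [NormedAddCommGroup F] [NormedSpace 𝕜 F] (X : Submodule 𝕜 (LInftyDualBall 𝕜 F)) [FiniteDimensional 𝕜 X]
    (ε : ℝ) (hε : 0 < ε) : ∃ P : LInftyDualBall 𝕜 F →L[𝕜] LInftyDualBall 𝕜 F,
      IsFiniteOp P ∧ ‖P‖ ≤ 1 + ε ∧ ∀ x ∈ X, P x = x :=
  exists_finite_fixing_linfty X hε

/-- `J_F U` extends along `J_G` with the same norm bound, by the extension property of `ℓ^∞`. -/
theorem IsBanachIdeal.inj_gauge_comp_left (hA : IsBanachIdeal A) (U : G →L[𝕜] F) (V : E →L[𝕜] G) :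
    A.inj.gauge (U ∘L V) ≤ ‖U‖ₑ * A.inj.gauge V := by
  obtain ⟨W, hW, hWn⟩ := exists_extension_linfty (canonicalEmbedding 𝕜 G)
    ((canonicalEmbedding 𝕜 F).toContinuousLinearMap ∘L U)
  have h1 : (canonicalEmbedding 𝕜 F).toContinuousLinearMap ∘L U ∘L V =
      W ∘L (canonicalEmbedding 𝕜 G).toContinuousLinearMap ∘L V := by
    rw [← ContinuousLinearMap.comp_assoc, ← hW, ContinuousLinearMap.comp_assoc]
  change A.gauge ((canonicalEmbedding 𝕜 F).toContinuousLinearMap ∘L U ∘L V) ≤ _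
  rw [h1]
  refine (hA.gauge_comp_left _ _).trans ?_
  change _ ≤ ‖U‖ₑ * A.gauge ((canonicalEmbedding 𝕜 G).toContinuousLinearMap ∘L V)
  gcongr
  refine (enorm_le_of_norm_le hWn).trans ((ContinuousLinearMap.opENorm_comp_le _ _).trans ?_)
  exact mul_le_of_le_one_left zero_le (enorm_linearIsometry_le _)

theorem IsBanachIdeal.inj_gauge_comp_right (hA : IsBanachIdeal A) (V : E →L[𝕜] F) (W : D →L[𝕜] E) :
    A.inj.gauge (V ∘L W) ≤ A.inj.gauge V * ‖W‖ₑ :=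
  hA.gauge_comp_right ((canonicalEmbedding 𝕜 F).toContinuousLinearMap ∘L V) W

theorem IsBanachIdeal.inj_gauge_comp_le (hA : IsBanachIdeal A) (U : F →L[𝕜] G) (V : E →L[𝕜] F)
    (W : D →L[𝕜] E) : A.inj.gauge (U ∘L V ∘L W) ≤ ‖U‖ₑ * A.inj.gauge V * ‖W‖ₑ := by
  refine (hA.inj_gauge_comp_left _ _).trans ?_
  rw [mul_assoc]
  gcongr
  exact hA.inj_gauge_comp_right _ _

theorem IsBanachIdeal.inj_gauge_smul (hA : IsBanachIdeal A) (c : 𝕜) (V : E →L[𝕜] F) :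
    A.inj.gauge (c • V) = ‖c‖ₑ * A.inj.gauge V := by
  change A.gauge ((canonicalEmbedding 𝕜 F).toContinuousLinearMap ∘L (c • V)) = _
  rw [ContinuousLinearMap.comp_smul, hA.gauge_smul]
  rfl

/-- `J_F` extends contractively along `J_G i`, so enlarging the target space cannot lower the
`A^inj`-norm. -/
theorem IsBanachIdeal.inj_gauge_le_of_isometry (hA : IsBanachIdeal A) {G : Type u}
    [NormedAddCommGroup G] [NormedSpace 𝕜 G] (i : F →ₗᵢ[𝕜] G)
    (S : E →L[𝕜] F) : A.inj.gauge S ≤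
      A.gauge ((canonicalEmbedding 𝕜 G).toContinuousLinearMap ∘L i.toContinuousLinearMap ∘L S) := by
  obtain ⟨W, hW, hWn⟩ := exists_extension_linfty ((canonicalEmbedding 𝕜 G).comp i)
    (canonicalEmbedding 𝕜 F).toContinuousLinearMap
  have h1 : (canonicalEmbedding 𝕜 F).toContinuousLinearMap ∘L S =
      W ∘L (canonicalEmbedding 𝕜 G).toContinuousLinearMap ∘L i.toContinuousLinearMap ∘L S := by
    rw [← hW]; rfl
  change A.gauge ((canonicalEmbedding 𝕜 F).toContinuousLinearMap ∘L S) ≤ _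
  rw [h1]
  refine (hA.gauge_comp_left _ _).trans (mul_le_of_le_one_left zero_le ?_)
  exact (enorm_le_of_norm_le hWn).trans (enorm_linearIsometry_le _)

theorem IsBanachIdeal.enorm_le_inj_gauge (hA : IsBanachIdeal A) (T : E →L[𝕜] F) :
    ‖T‖ₑ ≤ A.inj.gauge T := by
  refine le_trans ?_ (hA.enorm_le_gauge _)
  refine enorm_le_of_norm_le (ContinuousLinearMap.opNorm_le_bound _ (norm_nonneg _) fun x => ?_)
  have := ((canonicalEmbedding 𝕜 F).toContinuousLinearMap ∘L T).le_opNorm x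
  rwa [ContinuousLinearMap.comp_apply, LinearIsometry.coe_toContinuousLinearMap,
    LinearIsometry.norm_map] at this

theorem IsBanachIdeal.inj_comp_approximable_gauge_le_min (hA : IsBanachIdeal A) (T : E →L[𝕜] F) :
    (A.inj.comp approximable).gauge T ≤ A.inj.min.gauge T := by
  refine le_of_forall_gt_imp_ge_of_dense fun c hc => ?_
  obtain ⟨G, _, _, _, H, _, _, _, W, V, U, hW, hV, hU, rfl, hlt⟩ :=
    exists_factorization_of_min_lt hc
  have h1 := hA.inj_gauge_comp_left U V
  have hV' : A.inj.gauge V ≠ ∞ := hV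
  have hUV : A.inj.Mem (U ∘L V) := ne_top_of_le_ne_top (by finiteness) h1
  calc (A.inj.comp approximable).gauge ((U ∘L V) ∘L W)
      ≤ A.inj.gauge (U ∘L V) * approximable.gauge W :=
        comp_gauge_le (approximable_mem_iff.2 hW) hUV
    _ ≤ ‖U‖ₑ * A.inj.gauge V * ‖W‖ₑ := by rw [approximable_gauge_of_mem hW]; gcongr
    _ ≤ c := hlt.le

/-- For `L = S R`, a finite `P` fixing the range of `J S R` gives `J L = P (J S) R`, with both outer
factors approximable. -/
theorem min_inj_gauge_le_of_finite {L : E →L[𝕜] F}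
    (hL : IsFiniteOp L) : A.min.inj.gauge L ≤ (A.inj.comp approximable).gauge L := by
  refine le_of_forall_gt_imp_ge_of_dense fun c hc => ?_
  obtain ⟨G, _, _, _, R, S, hR, hS, rfl, hlt⟩ := exists_factorization_of_comp_lt hc
  have hR' := approximable_mem_iff.1 hR
  rw [approximable_gauge_of_mem hR'] at hlt
  obtain ⟨ε, hε, hεc⟩ := exists_pos_mul_lt hlt
  set J := (canonicalEmbedding 𝕜 F).toContinuousLinearMap
  have hJL : IsFiniteOp (J ∘L S ∘L R) := hL.comp_left J
  have : FiniteDimensional 𝕜 (LinearMap.range (J ∘L S ∘L R).toLinearMap) := hJL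
  obtain ⟨P, hP, hPn, hPL⟩ :=
    linftyDualBall_fixing (LinearMap.range (J ∘L S ∘L R).toLinearMap) ε hε
  have h1 : P ∘L (J ∘L S) ∘L R = J ∘L S ∘L R := by
    ext1 x
    exact hPL _ ⟨x, rfl⟩
  change A.min.gauge (J ∘L S ∘L R) ≤ c
  rw [← h1]
  have hPe : ‖P‖ₑ ≤ ENNReal.ofReal (1 + ε) := by
    rw [← ofReal_norm]
    exact ENNReal.ofReal_le_ofReal hPn
  have h1ε : 1 ≤ ENNReal.ofReal (1 + ε) := ENNReal.one_le_ofReal.2 (by linarith)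
  refine (min_gauge_le (W := R) (V := J ∘L S) (U := P) hR' hS hP.mem_closure).trans
    (le_trans ?_ hεc.le)
  calc ‖P‖ₑ * A.gauge (J ∘L S) * ‖R‖ₑ ≤ ENNReal.ofReal (1 + ε) * A.gauge (J ∘L S) * ‖R‖ₑ := by
        gcongr
    _ = A.gauge (J ∘L S) * ‖R‖ₑ * (ENNReal.ofReal (1 + ε) * 1) := by ring
    _ ≤ A.gauge (J ∘L S) * ‖R‖ₑ * (ENNReal.ofReal (1 + ε) * ENNReal.ofReal (1 + ε)) := by
        gcongr

theorem IsBanachIdeal.min_gauge_ne_top (hA : IsBanachIdeal A) {L : E →L[𝕜] F}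
    (hL : IsFiniteOp L) : A.min.gauge L ≠ ∞ := by
  have : FiniteDimensional 𝕜 (LinearMap.range L.toLinearMap) := hL
  have : CompleteSpace (LinearMap.range L.toLinearMap) := FiniteDimensional.complete 𝕜 _
  have hid := hA.gauge_ne_top_of_finiteDimensional_right
    (ContinuousLinearMap.id 𝕜 (LinearMap.range L.toLinearMap))
  have h := min_gauge_le (A := A)
    (IsFiniteOp.of_finiteDimensional_right (rangeRestrictL L)).mem_closure hid
    (IsFiniteOp.of_finiteDimensional_left (LinearMap.range L.toLinearMap).subtypeL).mem_closure
  rw [ContinuousLinearMap.id_comp, subtypeL_comp_rangeRestrictL] at h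
  exact ne_top_of_le_ne_top (by finiteness) h

/-- For finite `U` and `W` this is the definition of `A^*(L)` combined with cyclicity of the trace.
Both sides are continuous in `(U, W)`, so the bound passes to the closure. -/
theorem adjoint_conjugate_gauge_le_min (T : E →L[𝕜] F) :
    A.adjoint.conjugate.gauge T ≤ A.min.gauge T := by
  refine conjugate_gauge_le fun c hc L hL => ?_
  obtain ⟨G, _, _, _, H, _, _, _, W, V, U, hW, hV, hU, rfl, hlt⟩ :=
    exists_factorization_of_min_lt hc
  -- An infinite `A^*(L)` makes the right side infinite because `c > 0`.
  rcases eq_or_ne (A.adjoint.gauge L) ∞ with htop | hLt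
  · rw [htop, ENNReal.mul_top]
    · exact le_top
    · exact (pos_of_gt hlt).ne'
  have : FiniteDimensional 𝕜 (LinearMap.range L.toLinearMap) := hL
  set X := LinearMap.range L.toLinearMap
  have hVt : A.gauge V ≠ ∞ := hV
  -- The trace is taken on the fixed finite-dimensional range of `L`, where it is continuous for the
  -- operator norm.
  let tr : StrongDual 𝕜 (X →L[𝕜] X) := LinearMap.toContinuousLinearMap
    (LinearMap.trace 𝕜 X ∘ₗ ContinuousLinearMap.coeLM 𝕜)
  have htr : ∀ (U : H →L[𝕜] F) (W : E →L[𝕜] G), finTrace ((U ∘L V ∘L W) ∘L L) =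
      tr (rangeRestrictL L ∘L U ∘L V ∘L W ∘L X.subtypeL) := fun U W => by
    have h1 : (U ∘L V ∘L W) ∘L L = (U ∘L V ∘L W ∘L X.subtypeL) ∘L rangeRestrictL L := rfl
    rw [h1, finTrace_eq_trace_comp]
    rfl
  have hfin : ∀ p ∈ {S : H →L[𝕜] F | IsFiniteOp S} ×ˢ {S : E →L[𝕜] G | IsFiniteOp S},
      ‖tr (rangeRestrictL L ∘L p.1 ∘L V ∘L p.2 ∘L X.subtypeL)‖ ≤
        (A.adjoint.gauge L).toReal * (‖p.1‖ * (A.gauge V).toReal * ‖p.2‖) := by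
    rintro ⟨U, W⟩ ⟨hU, hW⟩
    change IsFiniteOp U at hU
    change IsFiniteOp W at hW
    change ‖tr (rangeRestrictL L ∘L U ∘L V ∘L W ∘L X.subtypeL)‖ ≤
      (A.adjoint.gauge L).toReal * (‖U‖ * (A.gauge V).toReal * ‖W‖)
    have h2 := enorm_finTrace_le (A := A) (T := L) hLt hU hV hW
    rw [finTrace_comp_comm ((hW.comp_left V).comp_left U) L, htr] at h2
    have h3 := ENNReal.toReal_mono (by finiteness) h2
    simpa [ENNReal.toReal_mul, mul_assoc] using h3
  have hclosed : IsClosed {p : (H →L[𝕜] F) × (E →L[𝕜] G) |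
      ‖tr (rangeRestrictL L ∘L p.1 ∘L V ∘L p.2 ∘L X.subtypeL)‖ ≤
        (A.adjoint.gauge L).toReal * (‖p.1‖ * (A.gauge V).toReal * ‖p.2‖)} :=
    isClosed_le (by fun_prop) (by fun_prop)
  have hmem : (U, W) ∈ closure ({S : H →L[𝕜] F | IsFiniteOp S} ×ˢ {S : E →L[𝕜] G | IsFiniteOp S}) :=
    by rw [closure_prod_eq]; exact ⟨hU, hW⟩
  have h4 : ‖tr (rangeRestrictL L ∘L U ∘L V ∘L W ∘L X.subtypeL)‖ ≤
      (A.adjoint.gauge L).toReal * (‖U‖ * (A.gauge V).toReal * ‖W‖) :=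
    closure_minimal hfin hclosed hmem
  rw [htr]
  have h5 := ENNReal.ofReal_le_ofReal h4
  rw [ENNReal.ofReal_mul ENNReal.toReal_nonneg, ENNReal.ofReal_mul (by positivity),
    ENNReal.ofReal_mul (by positivity), ENNReal.ofReal_toReal hLt, ENNReal.ofReal_toReal hVt,
    ofReal_norm, ofReal_norm, ofReal_norm] at h5
  calc _ ≤ _ := h5
    _ ≤ A.adjoint.gauge L * c := by gcongr
    _ = c * A.adjoint.gauge L := mul_comm _ _

end Injective

end

/-! ### Gluing countably many factorizations. -/

section

variable {𝕜 : Type} [RCLike 𝕜] {A : OperatorClass.{u} 𝕜}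
variable {E F : Type u} [NormedAddCommGroup E] [NormedSpace 𝕜 E] [CompleteSpace E]
  [NormedAddCommGroup F] [NormedSpace 𝕜 F] [CompleteSpace F]

/-- A countable family of Banach spaces sits, with contractive injections and projections, in a
single Banach space. -/
theorem exists_sum_space (H : ℕ → Type u) [∀ n, NormedAddCommGroup (H n)]
    [∀ n, NormedSpace 𝕜 (H n)] [∀ n, CompleteSpace (H n)] :
    ∃ (Z : Type u) (_ : NormedAddCommGroup Z) (_ : NormedSpace 𝕜 Z) (_ : CompleteSpace Z)
      (ι : ∀ n, H n →L[𝕜] Z) (π : ∀ n, Z →L[𝕜] H n), (∀ n, ‖ι n‖ ≤ 1) ∧ (∀ n, ‖π n‖ ≤ 1) ∧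
      (∀ n, π n ∘L ι n = ContinuousLinearMap.id 𝕜 (H n)) ∧
      ∀ m n, n ≠ m → π m ∘L ι n = 0 := by
  refine ⟨lp H ∞, inferInstance, inferInstance, inferInstance,
    fun n => lp.singleContinuousLinearMap 𝕜 H ∞ n, fun n => lp.evalCLM 𝕜 H ∞ n,
    fun n => ?_, fun n => ?_, fun n => ?_, fun m n hmn => ?_⟩
  · refine ContinuousLinearMap.opNorm_le_bound _ zero_le_one fun x => ?_
    rw [one_mul, lp.singleContinuousLinearMap_apply, lp.norm_single (by simp)]
  · refine ContinuousLinearMap.opNorm_le_bound _ zero_le_one fun x => ?_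
    rw [one_mul]
    exact lp.norm_apply_le_norm ENNReal.top_ne_zero x n
  · ext x
    change (lp.single ∞ n x : lp H ∞) n = x
    simp
  · ext x
    change (lp.single ∞ n x : lp H ∞) m = 0
    rw [lp.single_apply_ne _ _ _ hmn.symm]

theorem mem_closure_finite_of_hasSum {E F : Type u} [NormedAddCommGroup E] [NormedSpace 𝕜 E]
    [NormedAddCommGroup F] [NormedSpace 𝕜 F] {T : ℕ → E →L[𝕜] F} {L : E →L[𝕜] F} (hL : HasSum T L)
    (hT : ∀ n, IsFiniteOp (T n)) : L ∈ closure {S : E →L[𝕜] F | IsFiniteOp S} :=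
  mem_closure_of_tendsto hL.tendsto_sum_nat <| Filter.Eventually.of_forall fun _ =>
    (finiteOps 𝕜 E F).sum_mem fun i _ => hT i

theorem norm_comp_le_of_le {V W X : Type*} [NormedAddCommGroup V] [NormedSpace 𝕜 V]
    [NormedAddCommGroup W] [NormedSpace 𝕜 W] [NormedAddCommGroup X] [NormedSpace 𝕜 X]
    {f : W →L[𝕜] X} {g : V →L[𝕜] W} {a b : ℝ} (hf : ‖f‖ ≤ a) (hg : ‖g‖ ≤ b) :
    ‖f ∘L g‖ ≤ a * b :=
  (ContinuousLinearMap.opNorm_comp_le _ _).trans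
    (mul_le_mul hf hg (norm_nonneg _) ((norm_nonneg _).trans hf))

/-- Summation of factorizations: a series of operators `Jₙ Vₙ Qₙ` with finite `Jₙ`, `Qₙ` belongs to
the minimal kernel of the injective hull. -/
theorem IsBanachIdeal.min_inj_gauge_le_of_hasSum (hA : IsBanachIdeal A) (G H : ℕ → Type u)
    [∀ n, NormedAddCommGroup (G n)] [∀ n, NormedSpace 𝕜 (G n)] [∀ n, CompleteSpace (G n)]
    [∀ n, NormedAddCommGroup (H n)] [∀ n, NormedSpace 𝕜 (H n)] [∀ n, CompleteSpace (H n)]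
    (Q : ∀ n, E →L[𝕜] G n) (V : ∀ n, G n →L[𝕜] H n) (J : ∀ n, H n →L[𝕜] F)
    (hQ : ∀ n, IsFiniteOp (Q n)) (hJ : ∀ n, IsFiniteOp (J n)) {a t : ℕ → ℝ} {α τ : ℝ}
    (ha : HasSum a α) (ht : HasSum t τ) (ht0 : ∀ n, 0 ≤ t n)
    (hQa : ∀ n, ‖Q n‖ ≤ a n) (hJa : ∀ n, ‖J n‖ ≤ a n)
    (hV : ∀ n, A.inj.gauge (V n) ≤ ENNReal.ofReal (t n))
    {T : E →L[𝕜] F} (hT : HasSum (fun n => J n ∘L V n ∘L Q n) T) :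
    A.inj.min.gauge T ≤ ENNReal.ofReal α * ENNReal.ofReal τ * ENNReal.ofReal α := by
  obtain ⟨Z, _, _, _, ι, π, hι, hπ, hπι, hπι0⟩ := exists_sum_space (𝕜 := 𝕜) G
  obtain ⟨Y, _, _, _, κ, ρ, hκ, hρ, hρκ, hρκ0⟩ := exists_sum_space (𝕜 := 𝕜) H
  have ha0 : ∀ n, 0 ≤ a n := fun n => (norm_nonneg _).trans (hQa n)
  have hVn : ∀ n, ‖V n‖ ≤ t n := fun n => by
    have h := (hA.enorm_le_inj_gauge (V n)).trans (hV n)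
    rw [← ofReal_norm] at h
    exact (ENNReal.ofReal_le_ofReal_iff (ht0 n)).1 h
  have bQ : ∀ n, ‖ι n ∘L Q n‖ ≤ a n := fun n => by
    simpa using norm_comp_le_of_le (hι n) (hQa n)
  have bJ : ∀ n, ‖J n ∘L ρ n‖ ≤ a n := fun n => by
    simpa using norm_comp_le_of_le (hJa n) (hρ n)
  have bV : ∀ n, ‖κ n ∘L V n ∘L π n‖ ≤ t n := fun n => by
    simpa using norm_comp_le_of_le (hκ n) (norm_comp_le_of_le (hVn n) (hπ n))
  -- The glued factors are `W = ∑ ι n Q n`, `S = ∑ κ n V n π n` and `U = ∑ J n ρ n`; orthogonality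
  -- of the summands leaves `U S W = ∑ J n V n Q n`.
  obtain ⟨W, hW⟩ : Summable fun n => ι n ∘L Q n := Summable.of_norm_bounded ha.summable bQ
  obtain ⟨U, hU⟩ : Summable fun n => J n ∘L ρ n := Summable.of_norm_bounded ha.summable bJ
  obtain ⟨S, hS⟩ : Summable fun n => κ n ∘L V n ∘L π n := Summable.of_norm_bounded ht.summable bV
  have hWn : ‖W‖ₑ ≤ ENNReal.ofReal α := by
    rw [← ofReal_norm]
    exact ENNReal.ofReal_le_ofReal (hW.norm_le_of_bounded ha bQ)
  have hUn : ‖U‖ₑ ≤ ENNReal.ofReal α := by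
    rw [← ofReal_norm]
    exact ENNReal.ofReal_le_ofReal (hU.norm_le_of_bounded ha bJ)
  have hSn : A.inj.gauge S ≤ ENNReal.ofReal τ := by
    have h1 : HasSum (fun n => (canonicalEmbedding 𝕜 Y).toContinuousLinearMap ∘L
        κ n ∘L V n ∘L π n) ((canonicalEmbedding 𝕜 Y).toContinuousLinearMap ∘L S) :=
      hS.mapL (ContinuousLinearMap.compL 𝕜 Z Y (LInftyDualBall 𝕜 Y)
        (canonicalEmbedding 𝕜 Y).toContinuousLinearMap)
    refine (hA.gauge_le_tsum _ h1).trans ?_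
    rw [← ht.tsum_eq, ENNReal.ofReal_tsum_of_nonneg ht0 ht.summable]
    refine ENNReal.tsum_le_tsum fun n => ?_
    refine (hA.inj_gauge_comp_le (κ n) (V n) (π n)).trans ?_
    calc _ ≤ 1 * ENNReal.ofReal (t n) * 1 := by
          gcongr
          · exact enorm_le_one_of_norm_le (hκ n)
          · exact hV n
          · exact enorm_le_one_of_norm_le (hπ n)
      _ = _ := by ring
  have e1 : ∀ m, π m ∘L W = Q m := fun m => by
    have h1 : HasSum (fun n => π m ∘L ι n ∘L Q n) (π m ∘L W) :=
      hW.mapL (ContinuousLinearMap.compL 𝕜 E Z (G m) (π m))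
    have h2 : HasSum (fun n => π m ∘L ι n ∘L Q n) (π m ∘L ι m ∘L Q m) :=
      hasSum_single m fun n hn => by
        rw [← ContinuousLinearMap.comp_assoc, hπι0 m n hn, ContinuousLinearMap.zero_comp]
    rw [h1.unique h2, ← ContinuousLinearMap.comp_assoc, hπι, ContinuousLinearMap.id_comp]
  have e2 : ∀ m, ρ m ∘L S = V m ∘L π m := fun m => by
    have h1 : HasSum (fun n => ρ m ∘L κ n ∘L V n ∘L π n) (ρ m ∘L S) :=
      hS.mapL (ContinuousLinearMap.compL 𝕜 Z Y (H m) (ρ m))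
    have h2 : HasSum (fun n => ρ m ∘L κ n ∘L V n ∘L π n) (ρ m ∘L κ m ∘L V m ∘L π m) :=
      hasSum_single m fun n hn => by
        rw [← ContinuousLinearMap.comp_assoc, hρκ0 m n hn, ContinuousLinearMap.zero_comp]
    rw [h1.unique h2, ← ContinuousLinearMap.comp_assoc, hρκ, ContinuousLinearMap.id_comp]
  have e3 : T = U ∘L S ∘L W := by
    have h1 : HasSum (fun n => (J n ∘L ρ n) ∘L S ∘L W) (U ∘L S ∘L W) :=
      hU.mapL ((ContinuousLinearMap.compL 𝕜 E Y F).flip (S ∘L W))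
    refine hT.unique ?_
    convert h1 using 2 with n
    rw [← e1 n, ContinuousLinearMap.comp_assoc, ← ContinuousLinearMap.comp_assoc (ρ n), e2 n]
    rfl
  rw [e3]
  refine (min_gauge_le (mem_closure_finite_of_hasSum hW fun n => (hQ n).comp_left _)
    (ne_top_of_le_ne_top ENNReal.ofReal_ne_top hSn)
    (mem_closure_finite_of_hasSum hU fun n => (hJ n).comp_right _)).trans ?_
  gcongr

/-! ### Consequences of `A^*`-local reflexivity for the injective hull. -/

section LocalReflexivity

/-- Under the principle of `A^*`-local reflexivity, a finite operator `L : E → F` factors through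
finite-dimensional spaces with `A^inj`-norm close to `(A^{*Δ})^inj(L)`. -/
theorem exists_finite_factorization (hA : IsBanachIdeal A) (hLRP : LocalReflexivity A.adjoint)
    {L : E →L[𝕜] F} (hL : IsFiniteOp L) {c : ℝ≥0∞} (hc : A.adjoint.conjugate.inj.gauge L < c) :
    ∃ (K : Submodule 𝕜 E) (_ : IsClosed (K : Set E)) (_ : FiniteDimensional 𝕜 (E ⧸ K))
      (N : Submodule 𝕜 F) (_ : FiniteDimensional 𝕜 N) (_ : CompleteSpace N) (S : (E ⧸ K) →L[𝕜] N),
      L = N.subtypeL ∘L S ∘L K.mkQL ∧ A.inj.gauge S ≤ c := by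
  set J := (canonicalEmbedding 𝕜 F).toContinuousLinearMap
  obtain ⟨K, hK, hKfin, S', hS', hS'c⟩ := exists_quotient_factorization hA hLRP
    (fun X _ ε hε => linftyDualBall_fixing X ε hε) (hL.comp_left J) hc
  have hN : FiniteDimensional 𝕜 (LinearMap.range L.toLinearMap) := hL
  have hNc : CompleteSpace (LinearMap.range L.toLinearMap) := FiniteDimensional.complete 𝕜 _
  have hJL : ∀ x, J (L x) = S' (K.mkQL x) := fun x => DFunLike.congr_fun hS' x
  -- `J` is injective, so `L` also vanishes on `K` and descends to the quotient with values in its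
  -- own range.
  have hker : K ≤ (rangeRestrictL L).ker := fun x hx => by
    have h1 : K.mkQL x = 0 := by simpa using hx
    have h2 : (canonicalEmbedding 𝕜 F) (L x) = 0 := by
      have := hJL x
      rw [h1, map_zero] at this
      exact this
    have h3 : L x = 0 := (canonicalEmbedding 𝕜 F).injective (h2.trans (map_zero _).symm)
    exact LinearMap.mem_ker.2 (Subtype.ext h3)
  refine ⟨K, hK, hKfin, LinearMap.range L.toLinearMap, hN, hNc,
    K.liftQL (rangeRestrictL L) hker, ?_, ?_⟩
  · ext x
    rfl
  · refine (hA.inj_gauge_le_of_isometry (LinearMap.range L.toLinearMap).subtypeₗᵢ _).trans ?_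
    have hJS : J ∘L (LinearMap.range L.toLinearMap).subtypeₗᵢ.toContinuousLinearMap ∘L
        K.liftQL (rangeRestrictL L) hker = S' := by
      ext1 q
      obtain ⟨x, rfl⟩ := K.mkQ_surjective q
      exact hJL x
    rwa [hJS]

theorem inj_min_gauge_le_conjugate (hA : IsBanachIdeal A) (hLRP : LocalReflexivity A.adjoint)
    {L : E →L[𝕜] F} (hL : IsFiniteOp L) :
    A.inj.min.gauge L ≤ A.adjoint.conjugate.inj.gauge L := by
  refine le_of_forall_gt_imp_ge_of_dense fun c hc => ?_
  rcases eq_or_ne c ∞ with rfl | hct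
  · exact le_top
  obtain ⟨K, hK, _, N, _, _, S, rfl, hS⟩ := exists_finite_factorization hA hLRP hL hc
  refine (min_gauge_le (IsFiniteOp.of_finiteDimensional_right _).mem_closure
    (ne_top_of_le_ne_top hct hS) (IsFiniteOp.of_finiteDimensional_left _).mem_closure).trans ?_
  calc _ ≤ 1 * c * 1 := by
        gcongr
        · exact enorm_subtypeL_le N
        · refine enorm_le_one_of_norm_le
            (ContinuousLinearMap.opNorm_le_bound _ zero_le_one fun x => ?_)
          rw [one_mul]
          exact Submodule.Quotient.norm_mk_le K x
    _ = c := by ring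

theorem conjugate_inj_gauge_le (A : OperatorClass.{u} 𝕜) {L : E →L[𝕜] F} (hL : IsFiniteOp L) :
    A.adjoint.conjugate.inj.gauge L ≤ (A.inj.comp approximable).gauge L :=
  (adjoint_conjugate_gauge_le_min _).trans (min_inj_gauge_le_of_finite hL)

theorem IsBanachIdeal.inj_gauge_le_inj_comp_approximable (hA : IsBanachIdeal A) (T : E →L[𝕜] F) :
    A.inj.gauge T ≤ (A.inj.comp approximable).gauge T := by
  refine le_of_forall_gt_imp_ge_of_dense fun c hc => ?_
  obtain ⟨G, _, _, _, R, S, hR, hS, rfl, hlt⟩ := exists_factorization_of_comp_lt hc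
  rw [approximable_gauge_of_mem (approximable_mem_iff.1 hR)] at hlt
  exact (hA.inj_gauge_comp_right S R).trans hlt.le

/-- Continuity at `η = 0`; the expression has the shape `α τ α` of the bound for glued series. -/
theorem exists_pos_weight {C ρ : ℝ} (hC : 0 ≤ C) (hρ : 0 ≤ ρ) {c : ℝ≥0∞}
    (h : ENNReal.ofReal C * ENNReal.ofReal ρ < c) :
    ∃ η : ℝ, 0 < η ∧ ENNReal.ofReal (1 + η) * ENNReal.ofReal ((C + η) * (ρ + η + η)) *
      ENNReal.ofReal (1 + η) < c := by
  have hcont : Continuous fun η : ℝ => ENNReal.ofReal ((1 + η) * ((C + η) * (ρ + η + η)) * (1 + η)) :=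
    ENNReal.continuous_ofReal.comp (by fun_prop)
  have h1 : ENNReal.ofReal ((1 + 0) * ((C + 0) * (ρ + 0 + 0)) * (1 + 0)) < c := by
    simpa [ENNReal.ofReal_mul hC] using h
  have hlim := (hcont.tendsto 0).mono_left (nhdsWithin_le_nhds (s := Set.Ioi 0))
  obtain ⟨η, hη, hpos⟩ := ((hlim.eventually (gt_mem_nhds h1)).and self_mem_nhdsWithin).exists
  have hpos' : 0 < η := hpos
  refine ⟨η, hpos', ?_⟩
  rwa [← ENNReal.ofReal_mul (by positivity), ← ENNReal.ofReal_mul (by positivity)]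

theorem inj_min_gauge_le_inj_comp_approximable (hA : IsBanachIdeal A)
    (hLRP : LocalReflexivity A.adjoint) (T : E →L[𝕜] F) :
    A.inj.min.gauge T ≤ (A.inj.comp approximable).gauge T := by
  refine le_of_forall_gt_imp_ge_of_dense fun c hc => ?_
  obtain ⟨G, _, _, _, R, S, hR, hS, rfl, hlt⟩ := exists_factorization_of_comp_lt hc
  have hR' := approximable_mem_iff.1 hR
  rw [approximable_gauge_of_mem hR'] at hlt
  have hSt : A.inj.gauge S ≠ ∞ := hS
  set C := (A.inj.gauge S).toReal
  have hC : 0 ≤ C := ENNReal.toReal_nonneg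
  have hSC : A.inj.gauge S = ENNReal.ofReal C := (ENNReal.ofReal_toReal hSt).symm
  rw [hSC, ← ofReal_norm] at hlt
  obtain ⟨η, hη, hηc⟩ := exists_pos_weight hC (norm_nonneg R) hlt
  let w : ℕ → ℝ := fun n => η / 2 / 2 ^ n
  have hw : HasSum w η := hasSum_geometric_two' η
  have hw0 : ∀ n, 0 < w n := fun n => by positivity
  -- Index `0` carries the main term. In `‖P n‖ ≤ a n ^ 2 * γ n`, one `a n` goes to each outer
  -- factor and `γ n` to the middle one.
  let a : ℕ → ℝ := fun n => Nat.casesOn n 1 w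
  let γ : ℕ → ℝ := fun n => Nat.casesOn n (‖R‖ + η) w
  have ha : HasSum a (1 + η) := by
    rw [add_comm]; exact (hasSum_nat_add_iff' 1).1 (by simpa [a] using hw)
  have hγ : HasSum γ (‖R‖ + η + η) := by
    rw [add_comm]; exact (hasSum_nat_add_iff' 1).1 (by simpa [γ] using hw)
  have ha0 : ∀ n, 0 < a n := fun n => by
    cases n with
    | zero => exact one_pos
    | succ n => exact hw0 n
  have hγ0 : ∀ n, 0 < γ n := fun n => by
    cases n with
    | zero => exact add_pos_of_nonneg_of_pos (norm_nonneg R) hη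
    | succ n => exact hw0 n
  -- The tolerance `w n ^ 3` equals `a (n + 1) ^ 2 * γ (n + 1)`; at index `0` it is the distance
  -- allowed from `P 0` to `R`.
  let b : ℕ → ℝ := fun n => Nat.casesOn n η (fun n => w n ^ 3)
  have hb0 : ∀ n, 0 < b n := fun n => by
    cases n with
    | zero => exact hη
    | succ n => exact pow_pos (hw0 n) 3
  obtain ⟨P, hP, hPfin, hP0, hPn⟩ := controlled_sum_of_mem_closure
    (s := finiteOps 𝕜 E G) hR' hb0
  have hPb : ∀ n, ‖P n‖ ≤ a n ^ 2 * γ n := fun n => by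
    cases n with
    | zero =>
      have h1 : ‖P 0‖ ≤ ‖P 0 - R‖ + ‖R‖ := by
        simpa using norm_add_le (P 0 - R) R
      have h2 : ‖P 0 - R‖ < η := by
        rw [sub_eq_neg_add, ← norm_neg]
        simpa [b, add_comm, sub_eq_add_neg] using hP0
      change ‖P 0‖ ≤ 1 ^ 2 * (‖R‖ + η)
      linarith
    | succ n =>
      have h1 : ‖P (n + 1)‖ < w n ^ 3 := hPn (n + 1) n.succ_pos
      change ‖P (n + 1)‖ ≤ w n ^ 2 * w n
      linarith [pow_succ (w n) 2]
  have ha1 : ∀ n, a n ≤ 1 + η := fun n => le_hasSum ha n fun m _ => (ha0 m).le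
  have hPsum : HasSum P R := by
    have h1 : Summable P := by
      refine Summable.of_norm_bounded (hγ.summable.mul_left ((1 + η) ^ 2)) fun n => ?_
      refine (hPb n).trans (mul_le_mul_of_nonneg_right ?_ (hγ0 n).le)
      exact pow_le_pow_left₀ (ha0 n).le (ha1 n) 2
    -- The controlled series converges along sums over `range (n + 1)`, hence the shift by one.
    have h2 := (Filter.tendsto_add_atTop_iff_nat 1).2 h1.hasSum.tendsto_sum_nat
    rw [← tendsto_nhds_unique h2 hP]
    exact h1.hasSum
  have hfac : ∀ n, ∃ (K : Submodule 𝕜 E) (_ : IsClosed (K : Set E))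
      (_ : FiniteDimensional 𝕜 (E ⧸ K)) (N : Submodule 𝕜 F) (_ : FiniteDimensional 𝕜 N)
      (_ : CompleteSpace N) (V : (E ⧸ K) →L[𝕜] N), S ∘L P n = N.subtypeL ∘L V ∘L K.mkQL ∧
        A.inj.gauge V ≤ ENNReal.ofReal ((C + η) * (a n ^ 2 * γ n)) := by
    intro n
    have hfin : IsFiniteOp (S ∘L P n) := IsFiniteOp.comp_left (hPfin n) S
    refine exists_finite_factorization hA hLRP hfin ?_
    have hPcl := IsFiniteOp.mem_closure (hPfin n)
    have h1 := (conjugate_inj_gauge_le A hfin).trans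
      (comp_gauge_le (approximable_mem_iff.2 hPcl) hS)
    rw [approximable_gauge_of_mem hPcl, hSC, ← ofReal_norm, ← ENNReal.ofReal_mul hC] at h1
    refine h1.trans_lt ?_
    have h2 : 0 < a n ^ 2 * γ n := mul_pos (pow_pos (ha0 n) 2) (hγ0 n)
    rw [ENNReal.ofReal_lt_ofReal_iff (by positivity)]
    calc C * ‖P n‖ ≤ C * (a n ^ 2 * γ n) := by gcongr; exact hPb n
      _ < (C + η) * (a n ^ 2 * γ n) := by gcongr; linarith
  choose K hK hKfin N hN hNc V hV hVle using hfac
  obtain ⟨α, hnorm, hα⟩ : ∃ α : ℕ → 𝕜, (∀ n, ‖α n‖ = a n) ∧ ∀ n, α n ≠ 0 :=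
    ⟨fun n => RCLike.ofReal (a n), fun n => by rw [RCLike.norm_ofReal, abs_of_pos (ha0 n)],
      fun n => RCLike.ofReal_ne_zero.2 (ha0 n).ne'⟩
  -- Scaling both outer maps by `α n` and the middle one by `(α n ^ 2)⁻¹` leaves the composition
  -- unchanged and makes all three norm sequences summable.
  refine (hA.min_inj_gauge_le_of_hasSum (fun n => E ⧸ K n) (fun n => N n)
    (fun n => α n • (K n).mkQL) (fun n => (α n ^ 2)⁻¹ • V n)
    (fun n => α n • (N n).subtypeL)
    (fun n => IsFiniteOp.of_finiteDimensional_right _)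
    (fun n => IsFiniteOp.of_finiteDimensional_left _) ha (hγ.mul_left (C + η))
    (fun n => mul_nonneg (by positivity) (hγ0 n).le) (fun n => ?_) (fun n => ?_) (fun n => ?_)
    ?_).trans hηc.le
  · rw [norm_smul, hnorm]
    refine mul_le_of_le_one_right (ha0 n).le
      (ContinuousLinearMap.opNorm_le_bound _ zero_le_one fun x => ?_)
    rw [one_mul]
    exact Submodule.Quotient.norm_mk_le (K n) x
  · rw [norm_smul, hnorm]
    exact mul_le_of_le_one_right (ha0 n).le (N n).norm_subtypeL_le
  · rw [hA.inj_gauge_smul, ← ofReal_norm, norm_inv, norm_pow, hnorm]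
    refine (mul_le_mul_right (hVle n) _).trans_eq ?_
    rw [← ENNReal.ofReal_mul (by have := (ha0 n).le; positivity)]
    congr 1
    have := (ha0 n).ne'
    field_simp
  · have h1 : HasSum (fun n => S ∘L P n) (S ∘L R) :=
      hPsum.mapL (ContinuousLinearMap.compL 𝕜 E G F S)
    convert h1 using 2 with n
    rw [hV n]
    ext x
    have hn := hα n
    simp only [ContinuousLinearMap.comp_apply, smul_apply, map_smul, smul_smul]
    rw [show α n * (α n ^ 2)⁻¹ * α n = 1 by field_simp, one_smul]

theorem inj_comp_approximable_gauge_le_inj [FiniteDimensional 𝕜 E] (S : E →L[𝕜] F) :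
    (A.inj.comp approximable).gauge S ≤ A.inj.gauge S := by
  rcases eq_or_ne (A.inj.gauge S) ∞ with h | h
  · rw [h]
    exact le_top
  have hid := (IsFiniteOp.of_finiteDimensional_left (ContinuousLinearMap.id 𝕜 E)).mem_closure
  refine (comp_gauge_le (approximable_mem_iff.2 hid) h).trans ?_
  rw [approximable_gauge_of_mem hid]
  exact mul_le_of_le_one_right zero_le enorm_id_le

theorem totallyAccessible_inj_comp_approximable (hA : IsBanachIdeal A)
    (hLRP : LocalReflexivity A.adjoint) : TotallyAccessible (A.inj.comp approximable) := by
  intro E F _ _ _ _ _ _ T hT ε hε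
  have hle := conjugate_inj_gauge_le A hT
  have hne : (A.inj.comp approximable).gauge T ≠ ∞ := by
    refine ne_top_of_le_ne_top ?_ ((hA.inj_comp_approximable_gauge_le_min T).trans
      (inj_min_gauge_le_conjugate hA hLRP hT))
    exact ne_top_of_le_ne_top (hA.min_gauge_ne_top (hT.comp_left _))
      (adjoint_conjugate_gauge_le_min _)
  -- A zero norm leaves no strict margin, but then `T = 0` and the factorization through zero spaces
  -- works.
  rcases eq_or_ne ((A.inj.comp approximable).gauge T) 0 with h0 | h0
  · have hT0 : T = 0 := by
      have h1 := (hA.enorm_le_inj_gauge T).trans (hA.inj_gauge_le_inj_comp_approximable T)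
      rw [h0, nonpos_iff_eq_zero, ← ofReal_norm, ENNReal.ofReal_eq_zero] at h1
      exact norm_le_zero_iff.1 h1
    have hcl : IsClosed ((⊤ : Submodule 𝕜 E) : Set E) := isClosed_univ
    have hz : (A.inj.comp approximable).gauge
        (0 : (E ⧸ (⊤ : Submodule 𝕜 E)) →L[𝕜] (⊥ : Submodule 𝕜 F)) = 0 := by
      refine le_antisymm ((inj_comp_approximable_gauge_le_inj _).trans_eq ?_) zero_le
      change A.gauge (_ ∘L 0) = 0
      rw [ContinuousLinearMap.comp_zero, hA.gauge_zero]
    refine ⟨⊤, hcl, inferInstance, ⊥, inferInstance, 0, by simp [hT0], ?_, ?_⟩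
    · rw [OperatorClass.Mem, hz]
      exact ENNReal.zero_ne_top
    · rw [hz]
      exact zero_le
  · have hlt : (A.inj.comp approximable).gauge T <
        ENNReal.ofReal (1 + ε) * (A.inj.comp approximable).gauge T := by
      conv_lhs => rw [← one_mul ((A.inj.comp approximable).gauge T)]
      exact ENNReal.mul_lt_mul_left h0 hne (ENNReal.one_lt_ofReal.2 (by linarith))
    obtain ⟨K, hK, hKfin, N, hN, hNc, S, hS, hSle⟩ :=
      exists_finite_factorization hA hLRP hT (hle.trans_lt hlt)
    have hct : ENNReal.ofReal (1 + ε) * (A.inj.comp approximable).gauge T ≠ ∞ := by finiteness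
    have hSI := inj_comp_approximable_gauge_le_inj (A := A) S
    exact ⟨K, hK, hKfin, N, hN, S, hS, ne_top_of_le_ne_top hct (hSI.trans hSle), hSI.trans hSle⟩

end LocalReflexivity

end

end OpIdeal

end

theorem theorem4p4 {𝕜 : Type} [RCLike 𝕜] (A : OpIdeal.OperatorClass.{u} 𝕜)
    (hA : OpIdeal.IsBanachIdeal A) (hLRP : OpIdeal.LocalReflexivity A.adjoint) :
    (∀ (E F : Type u) [NormedAddCommGroup E] [NormedSpace 𝕜 E] [CompleteSpace E]
        [NormedAddCommGroup F] [NormedSpace 𝕜 F] [CompleteSpace F] (T : E →L[𝕜] F),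
        (A.inj.comp OpIdeal.approximable).gauge T = A.inj.min.gauge T) ∧
      OpIdeal.TotallyAccessible (A.inj.comp OpIdeal.approximable) ∧
      (∀ (E F : Type u) [NormedAddCommGroup E] [NormedSpace 𝕜 E] [CompleteSpace E]
        [NormedAddCommGroup F] [NormedSpace 𝕜 F] [CompleteSpace F] (L : E →L[𝕜] F),
        OpIdeal.IsFiniteOp L →
        A.inj.min.gauge L ≠ ∞ ∧
          A.inj.min.gauge L = A.adjoint.conjugate.inj.gauge L ∧
          A.adjoint.conjugate.inj.gauge L = A.min.inj.gauge L) := by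
  refine ⟨fun E F _ _ _ _ _ _ T => le_antisymm (hA.inj_comp_approximable_gauge_le_min T)
      (OpIdeal.inj_min_gauge_le_inj_comp_approximable hA hLRP T),
    OpIdeal.totallyAccessible_inj_comp_approximable hA hLRP, fun E F _ _ _ _ _ _ L hL => ?_⟩
  -- The three bounds close the cycle of inequalities, so all terms are equal.
  have h1 := OpIdeal.inj_min_gauge_le_conjugate hA hLRP hL
  have h2 : A.adjoint.conjugate.inj.gauge L ≤ A.min.inj.gauge L :=
    OpIdeal.adjoint_conjugate_gauge_le_min _
  have h3 := (OpIdeal.min_inj_gauge_le_of_finite (A := A) hL).trans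
    (hA.inj_comp_approximable_gauge_le_min L)
  exact ⟨ne_top_of_le_ne_top (hA.min_gauge_ne_top (hL.comp_left _)) (h1.trans h2),
    le_antisymm h1 (h2.trans h3), le_antisymm h2 (h3.trans h1)⟩
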